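/- Let $\mathbb D=\{t\in\mathbb C:|t|<1\}$, let $\sigma$ be normalized arc length on $\partial\mathbb D$, and for $h\in L^1(\partial\mathbb D)$ let $P[h](t)=P[h(s)](t)=\int_{\partial\mathbb D}\frac{1-|t|^2}{|s-t|^2}\,h(s)\,d\sigma(s)$, $t\in\mathbb D$, be its Poisson integral. For $r\in[1,\infty]$, $H^r(\mathbb D,\mathbb C^n)$ is the Hardy space of holomorphic functions $F:\mathbb D\to\mathbb C^n$ of the form $F=P[F_b]$ with $F_b\in L^r(\partial\mathbb D,\mathbb C^n)$; we write $F(s)$ for the boundary value $F_b(s)$, $s\in\partial\mathbb D$. Write $z\cdot w=\sum_j z_jw_j$ for $z,w\in\mathbb C^n$, and let $|\cdot|$ be the Euclidean norm. Let $p\in(1,\infty]$ and $q=p/(p-1)\in[1,\infty)$ (so $q=1$ if $p=\infty$). Let $\phi:\partial\mathbb D\times\mathbb C^n\to\mathbb R\cup\{+\infty\}$ be Borel measurable such that for every $s\in\partial\mathbb D$ the function $\phi_s=\phi(s,\cdot)$ is convex on $\mathbb C^n$. Assume that $\phi$ satisfies the $p$-uniform growth conditions: there are constants $c,C,A>0$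 such that for all $s\in\partial\mathbb D$ and $w\in\mathbb C^n$, $$c|w|^p-A\le\phi_s(w)\le C|w|^p+A\quad\text{if }p<\infty,\qquad \chi(c|w|)-A\le\phi_s(w)\le\chi(C|w|)+A\quad\text{if }p=\infty,$$ where $\chi(x)=0$ for $x\le1$ and $\chi(x)=+\infty$ for $x>1$; when $p=\infty$ assume also that every $\phi_s$ is lower semicontinuous. For $f_0\in L^1(\partial\mathbb D,\mathbb C)$ and $f\in H^q(\mathbb D,\mathbb C^n)$ put $L_{f_0,f}(t,w)=\operatorname{Re}(f(t)\cdot w)-P[\operatorname{Re}f_0](t)$ for $(t,w)\in\mathbb D\times\mathbb C^n$, and write $L_{f_0,f}\preceq\phi$ if for almost every $s\in\partial\mathbb D$ and every $z\in\mathbb C^n$, $$\limsup_{(0,1)\times\mathbb C^n\ni(r,w)\to(1,z)}L_{f_0,f}(rs,w)\le\phi(s,z).$$ Define, for $(t,w)\in\mathbb D\times\mathbb C^n$, $$\tilde\phi(t,w)=\sup\{L_{f_0,f}(t,w):\ f_0\in L^1(\partial\mathbb D,\mathbb C),\ f\in H^q(\mathbb D,\mathbb C^n),\ L_{f_0,f}\preceq\phi\}\in(-\infty,+\infty].$$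 Then for every $(t_0,w_0)\in\mathbb D\times\mathbb C^n$ with $\tilde\phi(t_0,w_0)<\infty$ there exists $F\in H^p(\mathbb D,\mathbb C^n)$ with $F(t_0)=w_0$ such that $s\mapsto\phi(s,F(s))$ is finite almost everywhere and integrable on $\partial\mathbb D$, and $$\tilde\phi(t,F(t))=P[\phi(s,F(s))](t)\qquad\text{for all }t\in\mathbb D.$$ In particular, $t\mapsto\tilde\phi(t,F(t))$ is (finite and) harmonic in $\mathbb D$. -/

import Mathlib

open MeasureTheory Filter Topology Set Metric
open scoped ENNReal

noncomputable section

namespace DiscInterpolation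

/-- The unit circle carries its Borel σ-algebra. -/
instance : MeasurableSpace Circle := borel Circle

instance : BorelSpace Circle := ⟨rfl⟩

/-- The normalized arc length `dσ = dθ / 2π` on the unit circle. -/
def arcMeasure : Measure Circle :=
  ENNReal.ofReal (2 * Real.pi)⁻¹ •
    Measure.map Circle.exp (volume.restrict (Ioc 0 (2 * Real.pi)))

/-- The Poisson integral `P[h](t) = ∫ (1 - |t|²) / |s - t|² h(s) dσ(s)`. -/
def poisson {E : Type*} [NormedAddCommGroup E] [NormedSpace ℝ E] (h : Circle → E) (t : ℂ) : E :=
  ∫ s : Circle, ((1 - ‖t‖ ^ 2) / ‖(s : ℂ) - t‖ ^ 2) • h s ∂arcMeasure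

/-- The bilinear (not sesquilinear) pairing `z · w = ∑ zⱼ wⱼ` on `ℂⁿ`. -/
def bil {n : ℕ} (z w : EuclideanSpace ℂ (Fin n)) : ℂ := ∑ j, z j * w j

/-- `F` belongs to the Hardy space `H^r(𝔻, ℂⁿ)` and has boundary values `Fb`: the function `F` is
holomorphic on the open unit disc and is there the Poisson integral of `Fb ∈ L^r(∂𝔻, ℂⁿ)`. -/
structure IsHardy {n : ℕ} (r : ℝ≥0∞) (F : ℂ → EuclideanSpace ℂ (Fin n))
    (Fb : Circle → EuclideanSpace ℂ (Fin n)) : Prop where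
  holomorphic : DifferentiableOn ℂ F (ball 0 1)
  memLp : MemLp Fb r arcMeasure
  eq_poisson : ∀ t ∈ ball (0 : ℂ) 1, F t = poisson Fb t

/-- A function `ℂⁿ → ℝ ∪ {+∞}` is convex if it is finite on a convex set, and is a finite convex
function on that set. -/
structure IsConvexFun {n : ℕ} (u : EuclideanSpace ℂ (Fin n) → EReal) : Prop where
  ne_bot : ∀ z, u z ≠ ⊥
  convexOn : ConvexOn ℝ {z | u z < ⊤} (fun z => (u z).toReal)

/-- `χ(x) = 0` for `x ≤ 1` and `χ(x) = +∞` for `x > 1`. -/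
def chi (x : ℝ) : EReal := if x ≤ 1 then 0 else ⊤

/-- The `p`-uniform growth conditions. For `p = ∞`, lower semicontinuity of every `φ s` is part of
the condition. -/
def UniformGrowth {n : ℕ} (p : ℝ≥0∞) (φ : Circle → EuclideanSpace ℂ (Fin n) → EReal) : Prop :=
  (∃ c C A : ℝ, 0 < c ∧ 0 < C ∧ 0 < A ∧ ∀ s w,
    if p = ∞ then
      chi (c * ‖w‖) - (A : EReal) ≤ φ s w ∧ φ s w ≤ chi (C * ‖w‖) + (A : EReal)
    else
      ((c * ‖w‖ ^ p.toReal - A : ℝ) : EReal) ≤ φ s w ∧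
        φ s w ≤ ((C * ‖w‖ ^ p.toReal + A : ℝ) : EReal)) ∧
  (p = ∞ → ∀ s, LowerSemicontinuous (φ s))

/-- The boundary relation `ψ ≼ φ` for a function `ψ` on `𝔻 × ℂⁿ`: for almost every `s ∈ ∂𝔻` and
every `z ∈ ℂⁿ`, the upper limit of `ψ(r s, w)` as `(0,1) × ℂⁿ ∋ (r, w) → (1, z)` is at most
`φ(s, z)`. -/
def BoundaryLE {n : ℕ} (ψ : ℂ → EuclideanSpace ℂ (Fin n) → ℝ)
    (φ : Circle → EuclideanSpace ℂ (Fin n) → EReal) : Prop :=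
  ∀ᵐ s : Circle ∂arcMeasure, ∀ z,
    limsup (fun x : ℝ × EuclideanSpace ℂ (Fin n) => ((ψ ((x.1 : ℂ) * (s : ℂ)) x.2 : ℝ) : EReal))
      (𝓝[Ioo (0 : ℝ) 1 ×ˢ univ] ((1 : ℝ), z)) ≤ φ s z

/-- `L_{f₀,f}(t,w) = Re (f(t) · w) - P[Re f₀](t)`. -/
def fiberLinear {n : ℕ} (f₀ : Circle → ℂ) (f : ℂ → EuclideanSpace ℂ (Fin n)) (t : ℂ)
    (w : EuclideanSpace ℂ (Fin n)) : ℝ :=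
  (bil (f t) w).re - poisson (fun s => (f₀ s).re) t

/-- The hull `φ̃(t,w)`: the supremum of `L_{f₀,f}(t,w)` over all `f₀ ∈ L¹(∂𝔻, ℂ)` and
`f ∈ H^q(𝔻, ℂⁿ)`, `1/p + 1/q = 1`, with `L_{f₀,f} ≼ φ`. -/
def hull {n : ℕ} (p : ℝ≥0∞) (φ : Circle → EuclideanSpace ℂ (Fin n) → EReal) (t : ℂ)
    (w : EuclideanSpace ℂ (Fin n)) : EReal :=
  sSup {x : EReal | ∃ (f₀ : Circle → ℂ) (f : ℂ → EuclideanSpace ℂ (Fin n))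
    (fb : Circle → EuclideanSpace ℂ (Fin n)),
      Integrable f₀ arcMeasure ∧ IsHardy (ENNReal.conjExponent p) f fb ∧
        BoundaryLE (fiberLinear f₀ f) φ ∧ x = ((fiberLinear f₀ f t w : ℝ) : EReal)}

end DiscInterpolation

end

/-! The argument is convex duality with respect to the harmonic measure of `t₀`. Let `m` be the
value of the hull at `(t₀, w₀)`, and let `φ_s*` be the convex conjugate of `φ_s`. The growth
conditions make `φ_s` uniformly superlinear, so `φ_s*` is finite and bounded on bounded sets,
uniformly in `s`.

Let `G` be in the disc algebra and let `g` be its coordinatewise conjugate on the circle. Young's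
inequality gives `Re (G(s)·z) - φ_s*(g(s)) ≤ φ_s(z)`. Replacing `φ_s*(g(s))` by a slightly larger
lower semicontinuous function (Vitali–Carathéodory) makes `G` admissible, so `Re (G(t₀)·w₀) ≤ ∫
φ_s*(g(s)) + m` (`re_bil_sub_le_hull`). Hence evaluation at `t₀`, a linear functional on a subspace
of the bounded measurable functions, is dominated by a convex integral functional.

`IsConvexIntegrand.exists_dual` extends the functional by Hahn–Banach. Domination forces absolute
continuity, so the extension is integration against some integrable `F`. Exchanging supremum and
integral then shows that the conjugate of `φ_s*` at `F(s)` has integral at most `m`. By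
Fenchel–Moreau (`le_of_forall_inner_sub_conjugate_le`) that conjugate dominates `φ(s, F(s))`, and
the growth conditions put `F` in `L^p`. Since `F` represents evaluation at `t₀` on the disc algebra,
its Poisson integral is holomorphic with value `w₀` at `t₀` (`isHardy_of_evalPairing`).

Conversely, an admissible `L` restricted to the graph of `F` is the Poisson integral of boundary
values that are at most `φ(s, F(s))`. So the hull is at most `P[φ(s, F(s))]` along `F`, with
equality at `t₀`. Harnack's inequality, applied to the nonnegative defects of almost optimal `L`,
carries the equality to every `t` (`hull_eq_poisson`). -/

namespace DiscInterpolation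

/-! ### Hahn–Banach extension under a convex majorant -/

/-- A linear functional that is dominated by a convex function on a subspace agrees on that subspace
with a linear functional dominated by the convex function everywhere. -/
theorem exists_linearMap_le_of_convexOn {X : Type*} [AddCommGroup X] [Module ℝ X]
    (Ψ : X → ℝ) (hΨ : ConvexOn ℝ univ Ψ) (V : Submodule ℝ X) (l : X →ₗ[ℝ] ℝ)
    (hl : ∀ v ∈ V, l v ≤ Ψ v) :
    ∃ Λ : X →ₗ[ℝ] ℝ, (∀ v ∈ V, Λ v = l v) ∧ ∀ x, Λ x ≤ Ψ x := by
  -- `Ψ` is convex but not sublinear, so the extension is done in `X × ℝ`, for functionals that are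
  -- nonnegative on the cone generated by the epigraph of `Ψ`. The case `c = 0` contributes the
  -- vertical ray.
  let C : PointedCone ℝ (X × ℝ) :=
    { carrier := {x | ∃ c : ℝ, 0 ≤ c ∧ ∃ y : X, x.1 = c • y ∧ c * Ψ y ≤ x.2}
      zero_mem' := ⟨0, le_rfl, 0, by simp, by simp⟩
      add_mem' := by
        rintro ⟨x₁, r₁⟩ ⟨x₂, r₂⟩ ⟨c₁, hc₁, y₁, h₁, h₁'⟩ ⟨c₂, hc₂, y₂, h₂, h₂'⟩
        simp only at h₁ h₁' h₂ h₂'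
        rcases (add_nonneg hc₁ hc₂).eq_or_lt with h | h
        · have e₁ : c₁ = 0 := by linarith
          have e₂ : c₂ = 0 := by linarith
          subst e₁ e₂
          refine ⟨0, le_rfl, 0, by simp [h₁, h₂], ?_⟩
          simp at h₁' h₂' ⊢
          linarith
        · refine ⟨c₁ + c₂, h.le, (c₁ / (c₁ + c₂)) • y₁ + (c₂ / (c₁ + c₂)) • y₂, ?_, ?_⟩
          · simp only [Prod.mk_add_mk, smul_add, smul_smul, h₁, h₂]
            rw [mul_div_cancel₀ _ h.ne', mul_div_cancel₀ _ h.ne']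
          · have := hΨ.2 (mem_univ y₁) (mem_univ y₂) (div_nonneg hc₁ h.le) (div_nonneg hc₂ h.le)
              (by field_simp)
            calc (c₁ + c₂) * Ψ ((c₁ / (c₁ + c₂)) • y₁ + (c₂ / (c₁ + c₂)) • y₂)
                ≤ (c₁ + c₂) * ((c₁ / (c₁ + c₂)) • Ψ y₁ + (c₂ / (c₁ + c₂)) • Ψ y₂) := by gcongr
              _ = c₁ * Ψ y₁ + c₂ * Ψ y₂ := by simp only [smul_eq_mul]; field_simp
              _ ≤ r₁ + r₂ := by linarith
      smul_mem' := by
        rintro ⟨a, ha⟩ ⟨x, r⟩ ⟨c, hc, y, h, h'⟩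
        simp only at h h'
        refine ⟨a * c, mul_nonneg ha hc, y, ?_, ?_⟩
        · change a • x = _
          rw [h, smul_smul]
        · change _ ≤ a * r
          rw [mul_assoc]
          gcongr }
  -- The functional `(v, r) ↦ r - l v` is nonnegative on the cone exactly because `l ≤ Ψ` on `V`.
  -- Its extension `g` satisfies `g (0, 1) = 1`, so `-g (·, 0)` is the required functional.
  let f : (X × ℝ) →ₗ.[ℝ] ℝ :=
    ⟨V.prod ⊤, (LinearMap.snd ℝ X ℝ - l.comp (LinearMap.fst ℝ X ℝ)).domRestrict _⟩
  have hf : ∀ x : f.domain, f x = (x : X × ℝ).2 - l (x : X × ℝ).1 := fun x => rfl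
  obtain ⟨g, hg, hgC⟩ := riesz_extension C f (by
      rintro ⟨⟨v, r⟩, hv⟩ ⟨c, hc, y, h, h'⟩
      have hv : v ∈ V := hv.1
      simp only at h h'
      rw [hf]
      simp only
      rcases hc.eq_or_lt with rfl | hc
      · simp at h h'
        simp [h, h']
      · have hy : y ∈ V := by
          have : y = c⁻¹ • v := by rw [h, smul_smul, inv_mul_cancel₀ hc.ne', one_smul]
          rw [this]
          exact V.smul_mem _ hv
        rw [h, map_smul, smul_eq_mul]
        nlinarith [hl y hy]) (by
      rintro ⟨y, r⟩
      refine ⟨⟨(0, Ψ y - r), V.zero_mem, trivial⟩, 1, zero_le_one, y, by simp, by simp⟩)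
  have hg1 : g (0, 1) = 1 := by
    have := hg ⟨(0, 1), V.zero_mem, trivial⟩
    rw [hf] at this
    simpa using this
  have hdecomp : ∀ (x : X) (r : ℝ), g (x, r) = g (x, 0) + r := by
    intro x r
    have : ((x, r) : X × ℝ) = (x, 0) + r • (0, 1) := by simp
    rw [this, map_add, map_smul, hg1, smul_eq_mul, mul_one]
  refine ⟨-(g.comp (LinearMap.inl ℝ X ℝ)), fun v hv => ?_, fun x => ?_⟩
  · have := hg ⟨(v, 0), hv, trivial⟩
    rw [hf] at this
    simp at this
    simp [this]
  · have := hgC (x, Ψ x) ⟨1, zero_le_one, x, by simp, by simp⟩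
    rw [hdecomp] at this
    simp
    linarith

/-! ### Densities of functionals on bounded measurable functions -/

variable {S : Type*} [MeasurableSpace S]

/-- The space of bounded measurable functions. -/
def boundedMeasurable (S E : Type*) [MeasurableSpace S] [NormedAddCommGroup E] [NormedSpace ℝ E]
    [MeasurableSpace E] [BorelSpace E] [SecondCountableTopology E] : Submodule ℝ (S → E) where
  carrier := {g | Measurable g ∧ ∃ C, ∀ s, ‖g s‖ ≤ C}
  zero_mem' := ⟨measurable_const, 0, by simp⟩
  add_mem' := by
    rintro f g ⟨hf, C, hC⟩ ⟨hg, D, hD⟩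
    exact ⟨hf.add hg, C + D, fun s => (norm_add_le _ _).trans (add_le_add (hC s) (hD s))⟩
  smul_mem' := by
    rintro a f ⟨hf, C, hC⟩
    refine ⟨hf.const_smul a, ‖a‖ * C, fun s => ?_⟩
    simp only [Pi.smul_apply, norm_smul]
    gcongr
    exact hC s

/-- A finitely additive set function that is small on sets of small measure has a density. -/
theorem exists_density (μ : Measure S) [IsFiniteMeasure μ] (ν : Set S → ℝ)
    (hadd : ∀ A B, MeasurableSet A → MeasurableSet B → Disjoint A B → ν (A ∪ B) = ν A + ν B)
    (hsmall : ∀ ε > 0, ∃ δ : ℝ≥0∞, 0 < δ ∧ ∀ A, MeasurableSet A → μ A < δ → |ν A| ≤ ε) :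
    ∃ h : S → ℝ, Integrable h μ ∧ ∀ A, MeasurableSet A → ν A = ∫ s in A, h s ∂μ := by
  classical
  have hempty : ν ∅ = 0 := by
    have := hadd ∅ ∅ .empty .empty (by simp)
    simp at this
    exact this
  have hfin : ∀ (A : ℕ → Set S), (∀ i, MeasurableSet (A i)) → Pairwise (Function.onFun Disjoint A) →
      ∀ t : Finset ℕ, ν (⋃ i ∈ t, A i) = ∑ i ∈ t, ν (A i) := by
    intro A hA hd t
    induction t using Finset.induction_on with
    | empty => simpa using hempty
    | insert a t ha ih =>
      rw [Finset.sum_insert ha, ← ih, Finset.set_biUnion_insert]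
      refine hadd _ _ (hA a) (Finset.measurableSet_biUnion _ fun i _ => hA i) ?_
      rw [disjoint_iUnion₂_right]
      intro i hi
      exact hd (by rintro rfl; exact ha hi)
  let s : SignedMeasure S :=
    { measureOf' := fun A => if MeasurableSet A then ν A else 0
      empty' := by simp [hempty]
      not_measurable' := fun A hA => by simp [hA]
      -- Countable additivity: what remains of a disjoint union after finitely many pieces has small
      -- `μ`-measure, so `hsmall` controls the error.
      m_iUnion' := by
        intro A hA hd
        simp only [hA, if_true, MeasurableSet.iUnion hA]
        rw [HasSum, SummationFilter.unconditional_filter, Metric.tendsto_atTop]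
        intro ε hε
        obtain ⟨δ, hδ, hν⟩ := hsmall (ε / 2) (half_pos hε)
        have hsum : ∑' i, μ (A i) ≠ ∞ := by
          rw [← measure_iUnion hd hA]
          exact measure_ne_top _ _
        have := (ENNReal.tendsto_tsum_compl_atTop_zero hsum).eventually (gt_mem_nhds hδ)
        obtain ⟨N, hN⟩ := eventually_atTop.1 this
        refine ⟨N, fun t ht => ?_⟩
        have hU : MeasurableSet (⋃ i ∈ t, A i) := Finset.measurableSet_biUnion _ fun i _ => hA i
        have hsub : (⋃ i ∈ t, A i) ⊆ ⋃ i, A i := iUnion₂_subset fun i _ => subset_iUnion A i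
        have hsplit := hadd (⋃ i ∈ t, A i) ((⋃ i, A i) \ ⋃ i ∈ t, A i) hU
          ((MeasurableSet.iUnion hA).diff hU) disjoint_sdiff_right
        rw [union_sdiff_cancel hsub, hfin A hA hd] at hsplit
        have hm : μ ((⋃ i, A i) \ ⋃ i ∈ t, A i) < δ := by
          refine lt_of_le_of_lt ?_ (hN t ht)
          refine (measure_mono ?_).trans (measure_iUnion_le fun i : {i // i ∉ t} => A i)
          rintro x ⟨hx, hx'⟩
          obtain ⟨i, hi⟩ := mem_iUnion.1 hx
          refine mem_iUnion.2 ⟨⟨i, fun h => hx' (mem_iUnion₂.2 ⟨i, h, hi⟩)⟩, hi⟩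
        have := hν _ ((MeasurableSet.iUnion hA).diff hU) hm
        rw [Real.dist_eq, hsplit, sub_add_cancel_left, abs_neg]
        linarith }
  have hs : ∀ A, MeasurableSet A → s A = ν A := fun A hA => if_pos hA
  have hac : s ≪ᵥ μ.toENNRealVectorMeasure := by
    refine VectorMeasure.AbsolutelyContinuous.mk fun A hA hμ => ?_
    rw [Measure.toENNRealVectorMeasure_apply_measurable hA] at hμ
    rw [hs A hA]
    refine abs_eq_zero.1 (le_antisymm (le_of_forall_pos_le_add fun ε hε => ?_) (abs_nonneg _))
    obtain ⟨δ, hδ, hν⟩ := hsmall ε hε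
    simpa using hν A hA (by rwa [hμ])
  refine ⟨s.rnDeriv μ, SignedMeasure.integrable_rnDeriv _ _, fun A hA => ?_⟩
  rw [← withDensityᵥ_apply (SignedMeasure.integrable_rnDeriv _ _) hA,
    SignedMeasure.withDensityᵥ_rnDeriv_eq s μ hac, hs A hA]

end DiscInterpolation

namespace DiscInterpolation

variable {S : Type*} [MeasurableSpace S]

/-- The indicator function of a measurable set. -/
noncomputable def boundedIndicator (A : Set S) (hA : MeasurableSet A) : boundedMeasurable S ℝ :=
  ⟨A.indicator 1, measurable_one.indicator hA, 1, fun s => by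
    by_cases hs : s ∈ A <;> simp [hs]⟩

theorem abs_le_mul_of_bound {l : boundedMeasurable S ℝ →ₗ[ℝ] ℝ} {M : ℝ}
    (hM : ∀ g : boundedMeasurable S ℝ, (∀ s, |g.1 s| ≤ 1) → |l g| ≤ M)
    (g : boundedMeasurable S ℝ) {c : ℝ} (hc : 0 < c) (hg : ∀ s, |g.1 s| ≤ c) : |l g| ≤ M * c := by
  have h1 : |l (c⁻¹ • g)| ≤ M := by
    refine hM _ fun s => ?_
    change |c⁻¹ * g.1 s| ≤ 1
    rw [abs_mul, abs_of_pos (inv_pos.2 hc), inv_mul_le_iff₀ hc, mul_one]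
    exact hg s
  rw [map_smul, smul_eq_mul, abs_mul, abs_of_pos (inv_pos.2 hc), inv_mul_le_iff₀ hc] at h1
  linarith

theorem integrable_boundedMeasurable_mul {μ : Measure S} {h : S → ℝ} (hh : Integrable h μ)
    (g : boundedMeasurable S ℝ) : Integrable (fun s => g.1 s * h s) μ := by
  obtain ⟨hg, C, hC⟩ := g.2
  exact hh.bdd_mul hg.aestronglyMeasurable (ae_of_all _ hC)

/-- A functional on bounded measurable functions which is bounded, and small on indicators of small
sets, is given by a density. -/
theorem exists_integral_eq_of_small (μ : Measure S) [IsFiniteMeasure μ]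
    (l : boundedMeasurable S ℝ →ₗ[ℝ] ℝ) (M : ℝ)
    (hM : ∀ g : boundedMeasurable S ℝ, (∀ s, |g.1 s| ≤ 1) → |l g| ≤ M)
    (hsmall : ∀ ε > 0, ∃ δ : ℝ≥0∞, 0 < δ ∧
      ∀ A (hA : MeasurableSet A), μ A < δ → |l (boundedIndicator A hA)| ≤ ε) :
    ∃ h : S → ℝ, Integrable h μ ∧ ∀ g : boundedMeasurable S ℝ, l g = ∫ s, g.1 s * h s ∂μ := by
  classical
  obtain ⟨h, hh, hν⟩ := exists_density μ
    (fun A => if hA : MeasurableSet A then l (boundedIndicator A hA) else 0) (by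
      intro A B hA hB hAB
      simp only [hA, hB, hA.union hB, dite_true]
      rw [← map_add]
      congr 1
      ext s
      change (A ∪ B).indicator (1 : S → ℝ) s = A.indicator 1 s + B.indicator 1 s
      rw [indicator_union_of_disjoint hAB]) (by
      intro ε hε
      obtain ⟨δ, hδ, H⟩ := hsmall ε hε
      exact ⟨δ, hδ, fun A hA hA' => by simpa only [hA, dite_true] using H A hA hA'⟩)
  refine ⟨h, hh, fun g => ?_⟩
  -- `D` vanishes on indicators and is bounded for the uniform norm, so it vanishes on uniform
  -- limits of simple functions.
  let D : boundedMeasurable S ℝ →ₗ[ℝ] ℝ :=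
    l - { toFun := fun g => ∫ s, g.1 s * h s ∂μ
          map_add' := fun f g => by
            rw [← integral_add (integrable_boundedMeasurable_mul hh f)
              (integrable_boundedMeasurable_mul hh g)]
            exact integral_congr_ae (ae_of_all _ fun s => add_mul _ _ _)
          map_smul' := fun a f => by
            simp only [RingHom.id_apply, smul_eq_mul]
            rw [← integral_const_mul]
            exact integral_congr_ae (ae_of_all _ fun s => mul_assoc _ _ _) }
  have hD : ∀ g, D g = l g - ∫ s, g.1 s * h s ∂μ := fun g => rfl
  have hDi : ∀ A hA, D (boundedIndicator A hA) = 0 := by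
    intro A hA
    have := hν A hA
    simp only [hA, dite_true] at this
    rw [hD, this, sub_eq_zero, ← integral_indicator hA]
    refine integral_congr_ae (ae_of_all _ fun s => ?_)
    by_cases hs : s ∈ A <;> simp [boundedIndicator, hs]
  have hDM : ∀ g : boundedMeasurable S ℝ, (∀ s, |g.1 s| ≤ 1) → |D g| ≤ M + ∫ s, |h s| ∂μ := by
    intro g hg
    rw [hD]
    refine (abs_sub _ _).trans (add_le_add (hM g hg) ?_)
    refine abs_integral_le_integral_abs.trans (integral_mono ?_ hh.abs fun s => ?_)
    · exact (integrable_boundedMeasurable_mul hh g).abs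
    · simp only [abs_mul]
      exact mul_le_of_le_one_left (abs_nonneg _) (hg s)
  suffices D g = 0 by rw [hD] at this; linarith
  obtain ⟨hgm, C, hC⟩ := g.2
  have key : ∀ N : ℕ, |D g| ≤ (M + ∫ s, |h s| ∂μ) * (1 / ((N : ℝ) + 1)) := by
    intro N
    have hN : (0 : ℝ) < N + 1 := by positivity
    have hfl : Measurable fun s => ⌊(N + 1 : ℝ) * g.1 s⌋ := (hgm.const_mul _).floor
    have hset : ∀ k : ℤ, MeasurableSet {s | ⌊(N + 1 : ℝ) * g.1 s⌋ = k} :=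
      fun k => hfl (measurableSet_singleton k)
    let K : ℤ := ⌈(N + 1 : ℝ) * C⌉ + 1
    -- The simple function `⌊(N + 1) g⌋ / (N + 1)`, within `1 / (N + 1)` of `g`; `K` is large enough
    -- to cover all values of the floor.
    let gN : boundedMeasurable S ℝ := ∑ k ∈ Finset.Icc (-K) K, ((k : ℝ) / (N + 1)) •
      boundedIndicator {s | ⌊(N + 1 : ℝ) * g.1 s⌋ = k} (hset k)
    have hgN : ∀ s, gN.1 s = ⌊(N + 1 : ℝ) * g.1 s⌋ / (N + 1 : ℝ) := by
      intro s
      have : gN.1 s = ∑ k ∈ Finset.Icc (-K) K, ((k : ℝ) / (N + 1)) *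
          ({s | ⌊(N + 1 : ℝ) * g.1 s⌋ = k} : Set S).indicator 1 s := by
        simp only [gN, AddSubmonoidClass.coe_finsetSum, Finset.sum_apply]
        rfl
      rw [this, Finset.sum_eq_single_of_mem ⌊(N + 1 : ℝ) * g.1 s⌋]
      · simp
      · rw [Finset.mem_Icc]
        have h1 := abs_le.1 (hC s)
        have h2 := Int.le_ceil ((N + 1 : ℝ) * C)
        constructor
        · rw [Int.le_floor]
          push_cast [K]
          nlinarith [h1.1]
        · have : ⌊(N + 1 : ℝ) * g.1 s⌋ ≤ ⌈(N + 1 : ℝ) * C⌉ :=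
            Int.cast_le.1 ((Int.floor_le _).trans (le_trans (by gcongr; exact h1.2) h2))
          omega
      · intro k _ hk
        rw [indicator_of_notMem, mul_zero]
        exact fun h => hk h.symm
    have h0 : D gN = 0 := by
      rw [map_sum]
      exact Finset.sum_eq_zero fun k _ => by rw [map_smul, hDi, smul_zero]
    have h1 := abs_le_mul_of_bound hDM (g - gN) (c := 1 / ((N : ℝ) + 1)) (by positivity) (by
      intro s
      change |g.1 s - gN.1 s| ≤ _
      rw [hgN, abs_of_nonneg]
      · have := Int.lt_floor_add_one ((N + 1 : ℝ) * g.1 s)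
        rw [sub_le_iff_le_add, ← add_div, le_div_iff₀ hN]
        linarith
      · have := Int.floor_le ((N + 1 : ℝ) * g.1 s)
        rw [sub_nonneg, div_le_iff₀ hN]
        linarith)
    rwa [map_sub, h0, sub_zero] at h1
  have hlim : Tendsto (fun N : ℕ => (M + ∫ s, |h s| ∂μ) * (1 / ((N : ℝ) + 1))) atTop (𝓝 0) := by
    simpa using tendsto_one_div_add_atTop_nhds_zero_nat.const_mul (M + ∫ s, |h s| ∂μ)
  exact abs_eq_zero.1 (le_antisymm (ge_of_tendsto' hlim key) (abs_nonneg _))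

/-! ### Convex integrands and duality for their integral functionals -/

variable {E : Type*} [NormedAddCommGroup E] [InnerProductSpace ℝ E]
  [MeasurableSpace E] [BorelSpace E] [SecondCountableTopology E]

/-- Multiplication of a bounded scalar function by a fixed vector. -/
def boundedSMul (v : E) : boundedMeasurable S ℝ →ₗ[ℝ] boundedMeasurable S E where
  toFun g := ⟨fun s => g.1 s • v, g.2.1.smul_const v, by
    obtain ⟨C, hC⟩ := g.2.2
    exact ⟨C * ‖v‖, fun s => by rw [norm_smul]; gcongr; exact hC s⟩⟩
  map_add' f g := by ext s; exact add_smul _ _ _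
  map_smul' a g := by ext s; exact mul_smul _ _ _

/-- An integrand `ψ(s, z)`, jointly measurable, convex in `z`, bounded below, and bounded above on
bounded sets of `z`. -/
structure IsConvexIntegrand (ψ : S → E → ℝ) : Prop where
  measurable : Measurable fun x : S × E => ψ x.1 x.2
  convex : ∀ s, ConvexOn ℝ univ (ψ s)
  bddBelow : ∃ A, ∀ s z, -A ≤ ψ s z
  bddAbove : ∀ R, ∃ M, ∀ s z, ‖z‖ ≤ R → ψ s z ≤ M

theorem IsConvexIntegrand.integrable {ψ : S → E → ℝ} (hψ : IsConvexIntegrand ψ)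
    {μ : Measure S} [IsFiniteMeasure μ] (g : boundedMeasurable S E) :
    Integrable (fun s => ψ s (g.1 s)) μ := by
  obtain ⟨A, hA⟩ := hψ.bddBelow
  obtain ⟨hg, C, hC⟩ := g.2
  obtain ⟨M, hM⟩ := hψ.bddAbove C
  refine Integrable.of_bound (C := max A M)
    (hψ.measurable.comp (measurable_id.prodMk hg)).aestronglyMeasurable (ae_of_all _ fun s => ?_)
  rw [Real.norm_eq_abs, abs_le]
  exact ⟨by linarith [hA s (g.1 s), le_max_left A M], (hM s _ (hC s)).trans (le_max_right _ _)⟩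

/-- A linear functional dominated by the integral of a convex integrand has a density. -/
theorem IsConvexIntegrand.exists_density [FiniteDimensional ℝ E] {ψ : S → E → ℝ} (hψ : IsConvexIntegrand ψ)
    (μ : Measure S) [IsProbabilityMeasure μ] (Λ : boundedMeasurable S E →ₗ[ℝ] ℝ) (m : ℝ)
    (hΛ : ∀ g, Λ g ≤ ∫ s, ψ s (g.1 s) ∂μ + m) :
    ∃ F : S → E, Measurable F ∧ Integrable F μ ∧
      ∀ g : boundedMeasurable S E, Λ g = ∫ s, inner ℝ (g.1 s) (F s) ∂μ := by
  have hbd : ∀ (R M : ℝ), (∀ s z, ‖z‖ ≤ R → ψ s z ≤ M) →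
      ∀ g : boundedMeasurable S E, (∀ s, ‖g.1 s‖ ≤ R) → |Λ g| ≤ M + m := by
    intro R M hM g hg
    have h : ∀ g : boundedMeasurable S E, (∀ s, ‖g.1 s‖ ≤ R) → Λ g ≤ M + m := by
      intro g hg
      refine (hΛ g).trans ?_
      gcongr
      calc ∫ s, ψ s (g.1 s) ∂μ ≤ ∫ s, M ∂μ :=
            integral_mono (hψ.integrable g) (integrable_const _) fun s => hM s _ (hg s)
        _ = M := by simp
    refine abs_le.2 ⟨?_, h g hg⟩
    have := h (-g) (fun s => by simpa using hg s)
    rw [map_neg] at this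
    linarith
  have hcoord : ∀ v : E, ‖v‖ ≤ 1 → ∃ h : S → ℝ, Integrable h μ ∧
      ∀ g : boundedMeasurable S ℝ, Λ (boundedSMul v g) = ∫ s, g.1 s * h s ∂μ := by
    intro v hv
    obtain ⟨M, hM⟩ := hψ.bddAbove 1
    refine exists_integral_eq_of_small μ (Λ.comp (boundedSMul v)) (M + m) (fun g hg => ?_) ?_
    · refine hbd 1 M hM _ fun s => ?_
      change ‖g.1 s • v‖ ≤ 1
      rw [norm_smul]
      exact mul_le_one₀ (hg s) (norm_nonneg _) hv
    · intro ε hε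
      obtain ⟨M₀, hM₀⟩ := hψ.bddAbove 0
      -- Test `Λ` on `±R • 1_A v`. The integrand is at most `M₀` off `A` and `M₁` on `A`, and `μ A`
      -- is so small that `A` costs at most 1. Thus `R |Λ (1_A v)| ≤ |M₀| + |m| + 1 = R ε / 2`.
      let R : ℝ := 2 * (|M₀| + |m| + 1) / ε
      have hR : 0 < R := by positivity
      obtain ⟨M₁, hM₁⟩ := hψ.bddAbove R
      refine ⟨ENNReal.ofReal ((|M₁| + |M₀| + 1)⁻¹), by simp; positivity, fun A hA hAδ => ?_⟩
      have hAδ' : μ.real A ≤ (|M₁| + |M₀| + 1)⁻¹ :=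
        ENNReal.toReal_le_of_le_ofReal (by positivity) hAδ.le
      have hone : ∀ c : ℝ, |c| = R →
          c * Λ (boundedSMul v (boundedIndicator A hA)) ≤ |M₀| + |m| + 1 := by
        intro c hc
        have e : c * Λ (boundedSMul v (boundedIndicator A hA)) =
          Λ (c • boundedSMul v (boundedIndicator A hA)) := by rw [map_smul, smul_eq_mul]
        rw [e]
        refine (hΛ _).trans ?_
        have : ∫ s, ψ s ((c • boundedSMul v (boundedIndicator A hA)).1 s) ∂μ ≤
            ∫ s, (M₀ + A.indicator (fun _ => |M₁| + |M₀|) s) ∂μ := by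
          refine integral_mono (hψ.integrable _)
            ((integrable_const _).add ((integrable_const _).indicator hA)) fun s => ?_
          change ψ s (c • (A.indicator (1 : S → ℝ) s • v)) ≤ _
          by_cases hs : s ∈ A
          · simp only [hs, indicator_of_mem, Pi.one_apply, one_smul]
            refine (hM₁ s _ ?_).trans ?_
            · rw [norm_smul, Real.norm_eq_abs, hc]
              exact mul_le_of_le_one_right hR.le hv
            · linarith [le_abs_self M₁, neg_abs_le M₀]
          · simp only [hs, not_false_eq_true, indicator_of_notMem, zero_smul, smul_zero, add_zero]
            exact hM₀ s 0 (by simp)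
        rw [integral_add (integrable_const _) ((integrable_const _).indicator hA),
          integral_indicator hA, setIntegral_const, integral_const] at this
        simp only [probReal_univ, smul_eq_mul, one_mul] at this
        have h3 : μ.real A * (|M₁| + |M₀|) ≤ 1 := by
          have : μ.real A * (|M₁| + |M₀| + 1) ≤ 1 := by
            rwa [← le_div_iff₀ (by positivity), one_div]
          nlinarith [measureReal_nonneg (μ := μ) (s := A)]
        linarith [le_abs_self m, le_abs_self M₀]
      change |Λ (boundedSMul v (boundedIndicator A hA))| ≤ ε
      have h1 := hone R (abs_of_pos hR)
      have h2 := hone (-R) (by rw [abs_neg, abs_of_pos hR])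
      have h3 : R * ε = 2 * (|M₀| + |m| + 1) := by simp only [R]; field_simp
      have h4 : 0 < |M₀| + |m| + 1 := by positivity
      rw [abs_le]
      constructor <;> by_contra! hcon <;> nlinarith
  let b := stdOrthonormalBasis ℝ E
  choose h hh hΛh using fun i => hcoord (b i) (by rw [b.orthonormal.1 i])
  let F₀ : S → E := fun s => ∑ i, h i s • b i
  have hF₀ : Integrable F₀ μ := integrable_finsetSum _ fun i _ => (hh i).smul_const _
  obtain ⟨F, hF, hFF₀⟩ := hF₀.aestronglyMeasurable
  refine ⟨F, hF.measurable, hF₀.congr hFF₀, fun g => ?_⟩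
  obtain ⟨hgm, C, hC⟩ := g.2
  let gi : Fin (Module.finrank ℝ E) → boundedMeasurable S ℝ := fun i =>
    ⟨fun s => inner ℝ (b i) (g.1 s), hgm.const_inner, C, fun s =>
      (norm_inner_le_norm _ _).trans (by rw [b.orthonormal.1 i, one_mul]; exact hC s)⟩
  have hg : g = ∑ i, boundedSMul (b i) (gi i) := by
    ext s
    rw [AddSubmonoidClass.coe_finsetSum, Finset.sum_apply]
    exact (b.sum_repr' (g.1 s)).symm
  conv_lhs => rw [hg, map_sum]
  simp only [hΛh]
  rw [← integral_finsetSum _ fun i _ => integrable_boundedMeasurable_mul (hh i) (gi i)]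
  refine integral_congr_ae (hFF₀.mono fun s hs => ?_)
  simp only [← hs, F₀, inner_sum, inner_smul_right, gi]
  exact Finset.sum_congr rfl fun i _ => by rw [real_inner_comm, mul_comm]

end DiscInterpolation

namespace DiscInterpolation

variable {S : Type*} [MeasurableSpace S]
  {E : Type*} [NormedAddCommGroup E] [InnerProductSpace ℝ E]
  [MeasurableSpace E] [BorelSpace E] [SecondCountableTopology E]

theorem integrable_boundedMeasurable_inner {μ : Measure S} {F : S → E} (hF : Integrable F μ)
    (g : boundedMeasurable S E) : Integrable (fun s => inner ℝ (g.1 s) (F s)) μ := by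
  obtain ⟨hg, C, hC⟩ := g.2
  refine (hF.norm.const_mul C).mono'
    (hg.aestronglyMeasurable.inner hF.aestronglyMeasurable) (ae_of_all _ fun s => ?_)
  refine (norm_inner_le_norm _ _).trans ?_
  gcongr
  exact hC s

/-- Interchange of supremum and integral over a sequence of test vectors. -/
theorem IsConvexIntegrand.exists_integrable_majorant {ψ : S → E → ℝ} (hψ : IsConvexIntegrand ψ)
    (μ : Measure S) [IsFiniteMeasure μ] {F : S → E} (hFm : Measurable F) (hF : Integrable F μ)
    (m : ℝ) (h : ∀ g : boundedMeasurable S E,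
      ∫ s, inner ℝ (g.1 s) (F s) ∂μ ≤ ∫ s, ψ s (g.1 s) ∂μ + m) (z : ℕ → E) :
    ∃ U : S → ℝ, Integrable U μ ∧ ∫ s, U s ∂μ ≤ m ∧
      ∀ᵐ s ∂μ, ∀ k, inner ℝ (z k) (F s) - ψ s (z k) ≤ U s := by
  classical
  let a : boundedMeasurable S E → S → ℝ := fun g s => inner ℝ (g.1 s) (F s) - ψ s (g.1 s)
  have ha : ∀ g, Measurable (a g) := fun g =>
    (g.2.1.inner hFm).sub (hψ.measurable.comp (measurable_id.prodMk g.2.1))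
  have hai : ∀ g, Integrable (a g) μ := fun g =>
    (integrable_boundedMeasurable_inner hF g).sub (hψ.integrable g)
  have ham : ∀ g, ∫ s, a g s ∂μ ≤ m := fun g => by
    rw [integral_sub (integrable_boundedMeasurable_inner hF g) (hψ.integrable g)]
    linarith [h g]
  let c : E → boundedMeasurable S E := fun v => ⟨fun _ => v, measurable_const, ‖v‖, fun _ => le_rfl⟩
  -- Switch to the constant `v` at the points where it does strictly better. The result is still a
  -- bounded measurable test function, so finite maxima obey the same integral bound `m`.
  let step : boundedMeasurable S E → E → boundedMeasurable S E := fun g v =>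
    ⟨fun s => if a g s < a (c v) s then v else g.1 s,
      Measurable.ite (measurableSet_lt (ha g) (ha (c v))) measurable_const g.2.1, by
      obtain ⟨C, hC⟩ := g.2.2
      refine ⟨max C ‖v‖, fun s => ?_⟩
      dsimp only
      split_ifs
      · exact le_max_right _ _
      · exact (hC s).trans (le_max_left _ _)⟩
  have hstep : ∀ g v s, a (step g v) s = max (a g s) (a (c v) s) := by
    intro g v s
    by_cases hlt : a g s < a (c v) s
    · rw [max_eq_right hlt.le]
      simp only [a, step, c] at hlt ⊢
      rw [if_pos hlt]
    · rw [max_eq_left (not_lt.1 hlt)]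
      simp only [a, step, c] at hlt ⊢
      rw [if_neg hlt]
  -- `a (G (k + 1))` is the maximum of `a (c (z i))` over `i ≤ k`; monotone convergence, starting
  -- from `a (G 0)`, bounds the integral of the supremum.
  let G : ℕ → boundedMeasurable S E := fun k => Nat.rec (c (z 0)) (fun k g => step g (z k)) k
  have hG : ∀ k, G (k + 1) = step (G k) (z k) := fun k => rfl
  have hmono : ∀ s, Monotone fun k => a (G k) s := fun s =>
    monotone_nat_of_le_succ fun k => by rw [hG, hstep]; exact le_max_left _ _
  let f : S → ℝ≥0∞ := fun s => ⨆ k, ENNReal.ofReal (a (G k) s - a (G 0) s)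
  have hfm : Measurable f := .iSup fun k => ((ha _).sub (ha _)).ennreal_ofReal
  have hfle : ∫⁻ s, f s ∂μ ≤ ENNReal.ofReal (m - ∫ s, a (G 0) s ∂μ) := by
    have hm : ∀ k, Measurable fun s => ENNReal.ofReal (a (G k) s - a (G 0) s) :=
      fun k => ((ha _).sub (ha _)).ennreal_ofReal
    rw [lintegral_iSup hm
      (fun i j hij s => ENNReal.ofReal_le_ofReal (sub_le_sub_right (hmono s hij) _))]
    refine iSup_le fun k => ?_
    have hi : Integrable (fun s => a (G k) s - a (G 0) s) μ := (hai _).sub (hai _)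
    rw [← ofReal_integral_eq_lintegral_ofReal hi
      (ae_of_all _ fun s => sub_nonneg.2 (hmono s (Nat.zero_le k)))]
    refine ENNReal.ofReal_le_ofReal ?_
    rw [integral_sub (hai _) (hai _)]
    linarith [ham (G k)]
  have hfin : ∫⁻ s, f s ∂μ ≠ ∞ := (hfle.trans_lt ENNReal.ofReal_lt_top).ne
  refine ⟨fun s => (f s).toReal + a (G 0) s,
    (integrable_toReal_of_lintegral_ne_top hfm.aemeasurable hfin).add (hai _), ?_, ?_⟩
  · rw [integral_add (integrable_toReal_of_lintegral_ne_top hfm.aemeasurable hfin) (hai _),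
      integral_toReal hfm.aemeasurable (ae_lt_top hfm hfin)]
    have := ENNReal.toReal_le_of_le_ofReal (by linarith [ham (G 0)]) hfle
    linarith
  · filter_upwards [ae_lt_top hfm hfin] with s hs k
    have h1 : inner ℝ (z k) (F s) - ψ s (z k) ≤ a (G (k + 1)) s := by
      rw [hG, hstep]
      exact le_max_right _ _
    have h2 : a (G (k + 1)) s - a (G 0) s ≤ (f s).toReal := by
      rw [← ENNReal.ofReal_le_iff_le_toReal hs.ne]
      exact le_iSup (fun k => ENNReal.ofReal (a (G k) s - a (G 0) s)) (k + 1)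
    linarith

/-- Duality for integral functionals: a functional dominated on a subspace by the integral of a
convex integrand is there the pairing with an integrable function `F`, and the conjugate integrand
at `F` has a small integral. -/
theorem IsConvexIntegrand.exists_dual [FiniteDimensional ℝ E] {ψ : S → E → ℝ}
    (hψ : IsConvexIntegrand ψ) (μ : Measure S) [IsProbabilityMeasure μ]
    (V : Submodule ℝ (boundedMeasurable S E)) (l : boundedMeasurable S E →ₗ[ℝ] ℝ) (m : ℝ)
    (hl : ∀ g ∈ V, l g ≤ ∫ s, ψ s (g.1 s) ∂μ + m) (z : ℕ → E) :
    ∃ F : S → E, Measurable F ∧ Integrable F μ ∧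
      (∀ g ∈ V, l g = ∫ s, inner ℝ (g.1 s) (F s) ∂μ) ∧
      ∃ U : S → ℝ, Integrable U μ ∧ ∫ s, U s ∂μ ≤ m ∧
        ∀ᵐ s ∂μ, ∀ k, inner ℝ (z k) (F s) - ψ s (z k) ≤ U s := by
  obtain ⟨Λ, hΛl, hΛ⟩ := exists_linearMap_le_of_convexOn
    (fun g : boundedMeasurable S E => ∫ s, ψ s (g.1 s) ∂μ + m) (by
      refine ⟨convex_univ, fun f _ g _ a b ha hb hab => ?_⟩
      simp only [smul_eq_mul]
      have : ∫ s, ψ s ((a • f + b • g).1 s) ∂μ ≤ ∫ s, (a * ψ s (f.1 s) + b * ψ s (g.1 s)) ∂μ :=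
        integral_mono (hψ.integrable _)
          (((hψ.integrable f).const_mul a).add ((hψ.integrable g).const_mul b)) fun s =>
          (hψ.convex s).2 (mem_univ _) (mem_univ _) ha hb hab
      rw [integral_add ((hψ.integrable f).const_mul a) ((hψ.integrable g).const_mul b),
        integral_const_mul, integral_const_mul] at this
      have hm : m = a * m + b * m := by rw [← add_mul, hab, one_mul]
      linarith) V l hl
  obtain ⟨F, hFm, hF, hΛF⟩ := hψ.exists_density μ Λ m hΛ
  refine ⟨F, hFm, hF, fun g hg => by rw [← hΛF, hΛl g hg],
    hψ.exists_integrable_majorant μ hFm hF m (fun g => by rw [← hΛF]; exact hΛ g) z⟩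

end DiscInterpolation

/-! ### Convex conjugates along a dense sequence, and Fenchel–Moreau -/

namespace DiscInterpolation

variable {E : Type*} [NormedAddCommGroup E] [InnerProductSpace ℝ E]

/-- An affine bound for a convex function, locally bounded above at the origin, follows from the
bound on a dense sequence. -/
theorem inner_sub_le_of_denseRange {D : Set E} {f : E → ℝ} (hf : ConvexOn ℝ D f) {δ B : ℝ}
    (hδ : 0 < δ) (hD : ball 0 δ ⊆ D) (hB : ∀ y ∈ ball (0 : E) δ, f y ≤ B) {w : ℕ → E}
    (hw : DenseRange w) {z : E} {c : ℝ} (h : ∀ j, w j ∈ D → inner ℝ z (w j) - f (w j) ≤ c)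
    {x : E} (hx : x ∈ D) : inner ℝ z x - f x ≤ c := by
  -- `f` need not be continuous at `x`, which may lie on the boundary of `D`. However, the ball of
  -- radius `θ δ` about `(1 - θ) x` lies in `D`, and there convexity gives `f ≤ (1 - θ) f x + θ B`.
  -- Take a point of the sequence in this ball and let `θ → 0`.
  have key : ∀ θ ∈ Ioo (0 : ℝ) 1,
      (1 - θ) * (inner ℝ z x - f x) ≤ c + θ * (B + ‖z‖ * δ) := by
    intro θ hθ
    obtain ⟨j, hj⟩ := hw.exists_mem_open (isOpen_ball (x := (1 - θ) • x) (ε := θ * δ))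
      ⟨_, mem_ball_self (mul_pos hθ.1 hδ)⟩
    obtain ⟨y, hy⟩ : ∃ y, y = θ⁻¹ • (w j - (1 - θ) • x) := ⟨_, rfl⟩
    have hyδ : ‖y‖ < δ := by
      rw [hy, norm_smul, norm_inv, Real.norm_eq_abs, abs_of_pos hθ.1, inv_mul_lt_iff₀ hθ.1]
      rwa [mem_ball_iff_norm] at hj
    have hyb : y ∈ ball (0 : E) δ := by simpa using hyδ
    have hwj : w j = (1 - θ) • x + θ • y := by
      rw [hy, smul_smul, mul_inv_cancel₀ hθ.1.ne', one_smul]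
      abel
    have hmem : w j ∈ D := by
      rw [hwj]
      exact hf.1 hx (hD hyb) (by linarith [hθ.2]) hθ.1.le (by ring)
    have h1 := h j hmem
    have h2 := hf.2 hx (hD hyb) (by linarith [hθ.2] : 0 ≤ 1 - θ) hθ.1.le (by ring)
    rw [← hwj] at h2
    have h3 : inner ℝ z (w j) = (1 - θ) * inner ℝ z x + θ * inner ℝ z y := by
      rw [hwj, inner_add_right, inner_smul_right, inner_smul_right]
    have h4 : -(‖z‖ * δ) ≤ inner ℝ z y := by
      have := abs_le.1 (abs_real_inner_le_norm z y)
      nlinarith [norm_nonneg z]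
    simp only [smul_eq_mul] at h2
    nlinarith [hB y hyb, hθ.1]
  have h1 : Tendsto (fun θ : ℝ => (1 - θ) * (inner ℝ z x - f x)) (𝓝[>] 0)
      (𝓝 ((1 - 0) * (inner ℝ z x - f x))) :=
    (Continuous.tendsto (by fun_prop) 0).mono_left nhdsWithin_le_nhds
  have h2 : Tendsto (fun θ : ℝ => c + θ * (B + ‖z‖ * δ)) (𝓝[>] 0)
      (𝓝 (c + 0 * (B + ‖z‖ * δ))) :=
    (Continuous.tendsto (by fun_prop) 0).mono_left nhdsWithin_le_nhds
  have h3 := le_of_tendsto_of_tendsto h1 h2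
    (mem_of_superset (Ioo_mem_nhdsGT one_pos) key)
  simpa using h3

/-- A lower semicontinuous convex function with values in `(-∞, +∞]` that is bounded above near the
origin and grows faster than any multiple of the norm. -/
structure IsSuperlinear (u : E → EReal) (δ B : ℝ) (N : ℝ → ℝ) : Prop where
  ne_bot : ∀ z, u z ≠ ⊥
  convexOn : ConvexOn ℝ {z | u z < ⊤} fun z => (u z).toReal
  lsc : LowerSemicontinuous u
  pos : 0 < δ
  le : ∀ z, ‖z‖ < δ → u z ≤ (B : EReal)
  ge : ∀ R z, ((R * ‖z‖ - N R : ℝ) : EReal) ≤ u z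

/-- The convex conjugate, computed along a dense sequence. -/
noncomputable def conjugate (w : ℕ → E) (u : E → EReal) (z : E) : ℝ :=
  (⨆ j, ((inner ℝ z (w j) : ℝ) : EReal) + -u (w j)).toReal

namespace IsSuperlinear

variable {u : E → EReal} {δ B : ℝ} {N : ℝ → ℝ} {w : ℕ → E}

theorem coe_toReal (hu : IsSuperlinear u δ B N) {x : E} (hx : u x < ⊤) :
    ((u x).toReal : EReal) = u x := EReal.coe_toReal hx.ne (hu.ne_bot x)

theorem toReal_ge (hu : IsSuperlinear u δ B N) (R : ℝ) {x : E} (hx : u x < ⊤) :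
    R * ‖x‖ - N R ≤ (u x).toReal := by
  rw [← EReal.coe_le_coe_iff, hu.coe_toReal hx]
  exact hu.ge R x

theorem lt_top_of_mem_ball (hu : IsSuperlinear u δ B N) {x : E} (hx : x ∈ ball 0 δ) : u x < ⊤ :=
  (hu.le x (by simpa using hx)).trans_lt (EReal.coe_lt_top B)

theorem toReal_le (hu : IsSuperlinear u δ B N) {x : E} (hx : x ∈ ball 0 δ) :
    (u x).toReal ≤ B := by
  rw [← EReal.coe_le_coe_iff, hu.coe_toReal (hu.lt_top_of_mem_ball hx)]
  exact hu.le x (by simpa using hx)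

theorem iSup_le_coe_iff (hu : IsSuperlinear u δ B N) {z : E} {c : ℝ} :
    ⨆ j, ((inner ℝ z (w j) : ℝ) : EReal) + -u (w j) ≤ (c : EReal) ↔
      ∀ j, u (w j) < ⊤ → inner ℝ z (w j) - (u (w j)).toReal ≤ c := by
  rw [iSup_le_iff]
  refine forall_congr' fun j => ?_
  rcases eq_or_lt_of_le (le_top (a := u (w j))) with h | h
  · simp [h]
  · rw [← hu.coe_toReal h]
    norm_cast
    simp [sub_eq_add_neg]

/-- The growth bound with slope `‖z‖` keeps the supremum below `N ‖z‖`, and a member of the sequence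
near the origin keeps it above `⊥`. So `toReal` in `conjugate` loses nothing. -/
theorem coe_conjugate (hu : IsSuperlinear u δ B N) (hw : DenseRange w) (z : E) :
    (conjugate w u z : EReal) = ⨆ j, ((inner ℝ z (w j) : ℝ) : EReal) + -u (w j) := by
  refine EReal.coe_toReal (ne_top_of_le_ne_top (EReal.coe_ne_top (N ‖z‖))
    (hu.iSup_le_coe_iff.2 fun j hj => ?_)) fun hbot => ?_
  · nlinarith [hu.toReal_ge ‖z‖ hj, real_inner_le_norm z (w j)]
  · obtain ⟨j, hj⟩ := hw.exists_mem_open isOpen_ball ⟨(0 : E), mem_ball_self hu.pos⟩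
    have := (iSup_eq_bot.1 hbot) j
    rw [← hu.coe_toReal (hu.lt_top_of_mem_ball hj)] at this
    norm_cast at this

theorem conjugate_le_iff (hu : IsSuperlinear u δ B N) (hw : DenseRange w) {z : E} {c : ℝ} :
    conjugate w u z ≤ c ↔ ∀ j, u (w j) < ⊤ → inner ℝ z (w j) - (u (w j)).toReal ≤ c := by
  rw [← EReal.coe_le_coe_iff, hu.coe_conjugate hw, hu.iSup_le_coe_iff]

/-- Young's inequality on the whole effective domain: although `conjugate` only sees the dense
sequence, it is the true convex conjugate. -/
theorem inner_sub_le_conjugate (hu : IsSuperlinear u δ B N) (hw : DenseRange w) (z : E) {x : E}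
    (hx : u x < ⊤) : inner ℝ z x - (u x).toReal ≤ conjugate w u z :=
  inner_sub_le_of_denseRange hu.convexOn hu.pos (fun _ hy => hu.lt_top_of_mem_ball hy)
    (fun _ hy => hu.toReal_le hy) hw ((hu.conjugate_le_iff hw).1 le_rfl) hx

theorem conjugate_ge (hu : IsSuperlinear u δ B N) (hw : DenseRange w) (z : E) :
    -B ≤ conjugate w u z := by
  have h0 : (0 : E) ∈ ball 0 δ := mem_ball_self hu.pos
  have := hu.inner_sub_le_conjugate hw z (hu.lt_top_of_mem_ball h0)
  have := hu.toReal_le h0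
  simp only [inner_zero_right] at *
  linarith

theorem conjugate_le (hu : IsSuperlinear u δ B N) (hw : DenseRange w) {z : E} {R : ℝ}
    (hz : ‖z‖ ≤ R) : conjugate w u z ≤ N R := by
  refine (hu.conjugate_le_iff hw).2 fun j hj => ?_
  nlinarith [hu.toReal_ge R hj, real_inner_le_norm z (w j), norm_nonneg (w j)]

theorem convexOn_conjugate (hu : IsSuperlinear u δ B N) (hw : DenseRange w) :
    ConvexOn ℝ univ (conjugate w u) := by
  refine ⟨convex_univ, fun z _ z' _ a b ha hb hab => (hu.conjugate_le_iff hw).2 fun j hj => ?_⟩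
  have h1 := (hu.conjugate_le_iff hw).1 (le_refl (conjugate w u z)) j hj
  have h2 := (hu.conjugate_le_iff hw).1 (le_refl (conjugate w u z')) j hj
  rw [inner_add_left, real_inner_smul_left, real_inner_smul_left, smul_eq_mul, smul_eq_mul]
  have : (u (w j)).toReal = a * (u (w j)).toReal + b * (u (w j)).toReal := by
    rw [← add_mul, hab, one_mul]
  nlinarith

/-- The Fenchel–Moreau theorem, with the biconjugate computed along a dense sequence. -/
theorem le_of_forall_inner_sub_conjugate_le [CompleteSpace E] (hu : IsSuperlinear u δ B N)
    (hw : DenseRange w) {z : ℕ → E} (hz : DenseRange z) {x : E} {U : ℝ}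
    (h : ∀ k, inner ℝ (z k) x - conjugate w u (z k) ≤ U) : u x ≤ (U : EReal) := by
  have hall : ∀ v, inner ℝ x v - conjugate w u v ≤ U := fun v =>
    inner_sub_le_of_denseRange (hu.convexOn_conjugate hw) one_pos (subset_univ _)
      (fun y hy => hu.conjugate_le hw (R := 1) (by simpa using (mem_ball.1 hy).le)) hz
      (fun k _ => by rw [real_inner_comm]; exact h k) (mem_univ v)
  have hconj : ∀ v c, (∀ y, u y < ⊤ → inner ℝ v y - (u y).toReal ≤ c) → conjugate w u v ≤ c :=
    fun v c hc => (hu.conjugate_le_iff hw).2 fun j hj => hc _ hj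
  by_contra! hlt
  -- If `U < u x`, the point `(x, U)` is separated strictly from the closed convex epigraph of `u`;
  -- the separating functional is `⟨g, y⟩ + β b`.
  let T : Set (E × ℝ) := {p | u p.1 ≤ (p.2 : EReal)}
  have hTc : IsClosed T := hu.lsc.isClosed_epigraph.preimage
    (continuous_fst.prodMk (continuous_coe_real_ereal.comp continuous_snd))
  have hTdom : ∀ p ∈ T, u p.1 < ⊤ := fun p hp => lt_of_le_of_lt hp (EReal.coe_lt_top _)
  have hT : Convex ℝ T := by
    rintro ⟨y₁, b₁⟩ h₁ ⟨y₂, b₂⟩ h₂ a b ha hb hab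
    have d₁ := hTdom _ h₁
    have d₂ := hTdom _ h₂
    change u (a • y₁ + b • y₂) ≤ ((a * b₁ + b * b₂ : ℝ) : EReal)
    rw [← hu.coe_toReal (hu.convexOn.1 d₁ d₂ ha hb hab), EReal.coe_le_coe_iff]
    refine (hu.convexOn.2 d₁ d₂ ha hb hab).trans ?_
    have e₁ : (u y₁).toReal ≤ b₁ := by rwa [← EReal.coe_le_coe_iff, hu.coe_toReal d₁]
    have e₂ : (u y₂).toReal ≤ b₂ := by rwa [← EReal.coe_le_coe_iff, hu.coe_toReal d₂]
    simp only [smul_eq_mul]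
    gcongr
  obtain ⟨f, c, hfx, hfT⟩ := geometric_hahn_banach_point_closed hT hTc
    (show (x, U) ∉ T from not_le.2 hlt)
  obtain ⟨g, hg⟩ : ∃ g : E, ∀ y, f (y, 0) = inner ℝ g y :=
    ⟨(InnerProductSpace.toDual ℝ E).symm (f.comp (ContinuousLinearMap.inl ℝ E ℝ)), fun y => by
      rw [InnerProductSpace.toDual_symm_apply]; rfl⟩
  obtain ⟨β, hβ⟩ : ∃ β : ℝ, β = f (0, 1) := ⟨_, rfl⟩
  have hf : ∀ y b, f (y, b) = inner ℝ g y + β * b := by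
    intro y b
    have : ((y, b) : E × ℝ) = (y, 0) + b • (0, 1) := by simp
    rw [this, map_add, map_smul, hg, ← hβ, smul_eq_mul, mul_comm]
  rw [hf] at hfx
  have hdom : ∀ y, u y < ⊤ → c < inner ℝ g y + β * (u y).toReal := by
    intro y hy
    rw [← hf]
    exact hfT _ (hu.coe_toReal hy).ge
  -- The epigraph contains a vertical upward ray over the origin, along which a negative `β` would
  -- violate the separation.
  have hβ0 : 0 ≤ β := by
    by_contra! hneg
    have hmem : ((0 : E), max B (c / β)) ∈ T :=
      (hu.le 0 (by simpa using hu.pos)).trans (EReal.coe_le_coe_iff.2 (le_max_left _ _))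
    have h1 := hfT _ hmem
    rw [hf, inner_zero_right, zero_add] at h1
    have h2 : β * max B (c / β) ≤ β * (c / β) :=
      mul_le_mul_of_nonpos_left (le_max_right _ _) hneg.le
    rw [mul_div_cancel₀ _ hneg.ne] at h2
    linarith
  rcases hβ0.eq_or_lt with h0 | hpos
  · subst h0
    simp only [zero_mul, add_zero] at hfx hdom
    -- A vertical hyperplane: `⟨g, ·⟩` alone separates `x` from the domain. Along the slopes `-k g`
    -- the conjugate is at most `-k c + N 0`, since `u ≥ -N 0`, and large `k` contradicts `hall`.
    obtain ⟨k, hk⟩ := exists_nat_gt ((U + N 0) / (c - inner ℝ g x))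
    rw [div_lt_iff₀ (by linarith)] at hk
    have h1 := hconj (-((k : ℝ) • g)) (-(k * c) + N 0) (by
      intro y hy
      have := hu.toReal_ge 0 hy
      rw [inner_neg_left, real_inner_smul_left]
      have := hdom y hy
      have : (k : ℝ) * c ≤ k * inner ℝ g y := by gcongr
      linarith)
    have h2 := hall (-((k : ℝ) • g))
    rw [inner_neg_right, inner_smul_right, real_inner_comm] at h2
    nlinarith
  -- A nonvertical hyperplane is the graph of an affine minorant of `u` with slope `-β⁻¹ g`; testing
  -- `hall` at that slope gives the contradiction.
  · have h1 := hconj (-(β⁻¹ • g)) (-(β⁻¹ * c)) (by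
      intro y hy
      rw [inner_neg_left, real_inner_smul_left]
      have h3 := mul_lt_mul_of_pos_left (hdom y hy) (inv_pos.2 hpos)
      rw [mul_add, ← mul_assoc, inv_mul_cancel₀ hpos.ne', one_mul] at h3
      linarith)
    have h2 := hall (-(β⁻¹ • g))
    rw [inner_neg_right, inner_smul_right, real_inner_comm] at h2
    have h3 := mul_lt_mul_of_pos_left hfx (inv_pos.2 hpos)
    rw [mul_add, ← mul_assoc, inv_mul_cancel₀ hpos.ne', one_mul] at h3
    linarith

end IsSuperlinear

/-- The conjugates of a measurable family of uniformly superlinear functions form a convex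
integrand. -/
theorem isConvexIntegrand_conjugate {S : Type*} [MeasurableSpace S] [MeasurableSpace E]
    [BorelSpace E] [SecondCountableTopology E] {φ : S → E → EReal} {δ B : ℝ} {N : ℝ → ℝ}
    (hφ : ∀ s, IsSuperlinear (φ s) δ B N) (hm : Measurable fun x : S × E => φ x.1 x.2)
    {w : ℕ → E} (hw : DenseRange w) : IsConvexIntegrand fun s z => conjugate w (φ s) z where
  -- Joint measurability is the reason for the dense sequence: the conjugate is a countable
  -- supremum.
  measurable := by
    refine (Measurable.iSup fun j => ?_).ereal_toReal
    have h1 : Measurable fun x : S × E => ((inner ℝ x.2 (w j) : ℝ) : EReal) :=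
      (measurable_snd.inner_const).coe_real_ereal
    have h2 : Measurable fun x : S × E => -φ x.1 (w j) := continuous_neg.measurable.comp
      (hm.comp (measurable_fst.prodMk (measurable_const (a := w j))))
    exact h1.add h2
  convex s := (hφ s).convexOn_conjugate hw
  bddBelow := ⟨B, fun s z => (hφ s).conjugate_ge hw z⟩
  bddAbove R := ⟨N R, fun s _ hz => (hφ s).conjugate_le hw hz⟩

end DiscInterpolation

/-! ### Consequences of the growth conditions -/

namespace DiscInterpolation

/-- Beyond the threshold `(|R| / c) ^ (1 / (P - 1))` the power dominates `|R| x`; below it `|R| x`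
is at most the constant `K`. -/
theorem exists_mul_le_rpow_add {c P : ℝ} (hc : 0 < c) (hP : 1 < P) (R : ℝ) :
    ∃ K, ∀ x, 0 ≤ x → R * x ≤ c * x ^ P + K := by
  refine ⟨|R| * (|R| / c) ^ (1 / (P - 1)), fun x hx => ?_⟩
  have h0 : 0 ≤ (|R| / c) ^ (1 / (P - 1)) := by positivity
  have h1 : R * x ≤ |R| * x := by gcongr; exact le_abs_self R
  refine h1.trans ?_
  rcases le_total x ((|R| / c) ^ (1 / (P - 1))) with h | h
  · have : 0 ≤ c * x ^ P := by positivity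
    nlinarith [abs_nonneg R]
  · have h2 : |R| / c ≤ x ^ (P - 1) := by
      calc |R| / c = ((|R| / c) ^ (1 / (P - 1))) ^ (P - 1) := by
            rw [← Real.rpow_mul (by positivity), one_div_mul_cancel (by linarith), Real.rpow_one]
        _ ≤ x ^ (P - 1) := by gcongr
    rw [div_le_iff₀ hc] at h2
    have h3 : x ^ P = x ^ (P - 1) * x := by
      rcases hx.eq_or_lt with rfl | hx
      · rw [Real.zero_rpow (by linarith), mul_zero]
      · rw [← Real.rpow_add_one hx.ne', sub_add_cancel]
    rw [h3]
    have : 0 ≤ |R| * (|R| / c) ^ (1 / (P - 1)) := by positivity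
    nlinarith

variable {n : ℕ}

/-- For finite `p` the functions `φ s` are finite and convex in finite dimension, hence continuous,
and `p > 1` gives superlinearity. For `p = ∞` the effective domains lie in the ball of radius `1 /
c`, and semicontinuity is part of the assumption. -/
theorem UniformGrowth.exists_isSuperlinear {p : ℝ≥0∞} (hp : 1 < p)
    {φ : Circle → EuclideanSpace ℂ (Fin n) → EReal} (hconv : ∀ s, IsConvexFun (φ s))
    (hφ : UniformGrowth p φ) :
    ∃ (δ B : ℝ) (N : ℝ → ℝ), ∀ s, IsSuperlinear (φ s) δ B N := by
  obtain ⟨⟨c, C, A, hc, hC, hA, h⟩, hlsc⟩ := hφ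
  by_cases hpt : p = ∞
  · simp only [hpt, if_true] at h
    refine ⟨1 / C, A, fun R => |R| / c + A, fun s =>
      ⟨(hconv s).ne_bot, (hconv s).convexOn, hlsc hpt s, by positivity, fun z hz => ?_,
        fun R z => ?_⟩⟩
    · refine (h s z).2.trans ?_
      rw [lt_div_iff₀' hC] at hz
      simp [chi, hz.le]
    · refine le_trans ?_ (h s z).1
      unfold chi
      split_ifs with hz
      · rw [zero_sub, ← EReal.coe_neg, EReal.coe_le_coe_iff]
        have : R * ‖z‖ ≤ |R| / c := by
          rw [le_div_iff₀ hc]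
          nlinarith [le_abs_self R, abs_nonneg R, mul_nonneg hc.le (norm_nonneg z)]
        linarith
      · rw [EReal.top_sub_coe]
        exact le_top
  · simp only [hpt, if_false] at h
    have hP : 1 < p.toReal := by
      rw [← ENNReal.toReal_one]
      exact ENNReal.toReal_strict_mono hpt hp
    choose K hK using exists_mul_le_rpow_add hc hP
    have hlt : ∀ s z, φ s z < ⊤ := fun s z => (h s z).2.trans_lt (EReal.coe_lt_top _)
    refine ⟨1, C + A, fun R => K R + A, fun s =>
      ⟨(hconv s).ne_bot, (hconv s).convexOn, ?_, one_pos, fun z hz => ?_, fun R z => ?_⟩⟩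
    · have h1 : ConvexOn ℝ univ fun z => (φ s z).toReal := by
        have := (hconv s).convexOn
        rwa [show {z | φ s z < ⊤} = univ from eq_univ_of_forall (hlt s)] at this
      have h2 : Continuous fun z => (φ s z).toReal := by
        have := h1.continuousOn_interior
        rwa [interior_univ, continuousOn_univ] at this
      have h3 : φ s = fun z => ((φ s z).toReal : EReal) := by
        ext z
        rw [EReal.coe_toReal (hlt s z).ne ((hconv s).ne_bot z)]
      rw [h3]
      exact (continuous_coe_real_ereal.comp h2).lowerSemicontinuous
    · refine (h s z).2.trans (EReal.coe_le_coe_iff.2 ?_)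
      have : ‖z‖ ^ p.toReal ≤ 1 := Real.rpow_le_one (norm_nonneg z) hz.le (by linarith)
      nlinarith
    · refine le_trans (EReal.coe_le_coe_iff.2 ?_) (h s z).1
      linarith [hK R ‖z‖ (norm_nonneg z)]

/-- The lower growth bound turns the integrable majorant `U` into one for `‖F‖ ^ p`; for `p = ∞`,
finiteness of `φ s (F s)` already forces `c ‖F s‖ ≤ 1`. -/
theorem UniformGrowth.memLp {p : ℝ≥0∞} (hp : 1 < p)
    {φ : Circle → EuclideanSpace ℂ (Fin n) → EReal} (hφ : UniformGrowth p φ)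
    {μ : Measure Circle} [IsFiniteMeasure μ] {F : Circle → EuclideanSpace ℂ (Fin n)}
    (hF : AEStronglyMeasurable F μ) {U : Circle → ℝ} (hU : Integrable U μ)
    (hFU : ∀ᵐ s ∂μ, φ s (F s) ≤ (U s : EReal)) : MemLp F p μ := by
  obtain ⟨⟨c, C, A, hc, hC, hA, h⟩, hlsc⟩ := hφ
  by_cases hpt : p = ∞
  · simp only [hpt, if_true] at h ⊢
    refine memLp_top_of_bound hF (1 / c) (hFU.mono fun s hs => ?_)
    have h1 := (h s (F s)).1.trans hs
    rw [le_div_iff₀' hc]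
    by_contra! hcon
    rw [chi, if_neg (not_le.2 hcon), EReal.top_sub_coe] at h1
    exact EReal.coe_ne_top _ (top_le_iff.1 h1)
  · simp only [hpt, if_false] at h
    rw [← integrable_norm_rpow_iff hF (zero_lt_one.trans hp).ne' hpt]
    refine ((hU.add (integrable_const A)).const_mul c⁻¹).mono'
      (hF.norm.aemeasurable.pow_const _).aestronglyMeasurable (hFU.mono fun s hs => ?_)
    have h1 := EReal.coe_le_coe_iff.1 ((h s (F s)).1.trans hs)
    rw [Real.norm_of_nonneg (by positivity), Pi.add_apply, le_inv_mul_iff₀ hc]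
    linarith

end DiscInterpolation

namespace DiscInterpolation

/-! ### The arc measure -/

theorem arcMeasure_eq_map : arcMeasure = Measure.map Circle.exp
    (ENNReal.ofReal (2 * Real.pi)⁻¹ • volume.restrict (Ioc 0 (2 * Real.pi))) :=
  (Measure.map_smul _ _ _).symm

theorem measurable_circleExp : Measurable (Circle.exp : ℝ → Circle) :=
  Circle.exp.continuous.measurable

instance : IsProbabilityMeasure arcMeasure where
  measure_univ := by
    rw [arcMeasure_eq_map, Measure.map_apply measurable_circleExp .univ]
    simp only [preimage_univ, Measure.smul_apply, Measure.restrict_apply_univ, Real.volume_Ioc,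
      sub_zero, smul_eq_mul]
    rw [← ENNReal.ofReal_mul (by positivity), inv_mul_cancel₀ (by positivity), ENNReal.ofReal_one]

theorem circleMap_zero_one (θ : ℝ) : circleMap 0 1 θ = (Circle.exp θ : ℂ) := by
  simp [circleMap_zero, Circle.coe_exp]

/-- The passage to circle averages, through which the Poisson and Herglotz formulas enter. -/
theorem integral_arcMeasure {E : Type*} [NormedAddCommGroup E] [NormedSpace ℝ E] {h : Circle → E}
    (hh : AEStronglyMeasurable h arcMeasure) {g : ℂ → E} (hg : ∀ s : Circle, g s = h s) :
    ∫ s, h s ∂arcMeasure = Real.circleAverage g 0 1 := by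
  rw [arcMeasure_eq_map] at hh ⊢
  rw [integral_map measurable_circleExp.aemeasurable hh, integral_smul_measure,
    Real.circleAverage_def, intervalIntegral.integral_of_le (by positivity),
    ENNReal.toReal_ofReal (by positivity)]
  simp only [circleMap_zero_one, hg]

theorem circleIntegrable_of_integrable {E : Type*} [NormedAddCommGroup E] [NormedSpace ℝ E]
    {h : Circle → E} (hh : Integrable h arcMeasure) {g : ℂ → E} (hg : ∀ s : Circle, g s = h s) :
    CircleIntegrable g 0 1 := by
  rw [arcMeasure, integrable_smul_measure (by simp; positivity) (by simp),
    integrable_map_measure] at hh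
  · rw [CircleIntegrable, intervalIntegrable_iff, uIoc_of_le (by positivity)]
    simp only [circleMap_zero_one, hg]
    exact hh
  · have := hh.aestronglyMeasurable
    exact this
  · exact measurable_circleExp.aemeasurable

theorem continuous_integrable {E : Type*} [NormedAddCommGroup E] {h : Circle → E}
    (hh : Continuous h) {μ : Measure Circle} [IsFiniteMeasure μ] : Integrable h μ :=
  hh.integrable_of_hasCompactSupport (HasCompactSupport.of_compactSpace h)

/-! ### The Poisson kernel -/

/-- The Poisson kernel of the unit disc. -/
noncomputable def kernel (t : ℂ) (s : Circle) : ℝ := (1 - ‖t‖ ^ 2) / ‖(s : ℂ) - t‖ ^ 2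

theorem poisson_def {E : Type*} [NormedAddCommGroup E] [NormedSpace ℝ E] (h : Circle → E) (t : ℂ) :
    poisson h t = ∫ s, kernel t s • h s ∂arcMeasure := rfl

variable {t : ℂ}

theorem sub_ne_zero_of_mem_ball (ht : t ∈ ball (0 : ℂ) 1) (s : Circle) : (s : ℂ) - t ≠ 0 := by
  rw [sub_ne_zero]
  rintro rfl
  simp [Circle.norm_coe] at ht

theorem kernel_pos (ht : t ∈ ball (0 : ℂ) 1) (s : Circle) : 0 < kernel t s := by
  have h1 : ‖t‖ < 1 := by simpa using ht
  have h2 : 0 < ‖(s : ℂ) - t‖ := norm_pos_iff.2 (sub_ne_zero_of_mem_ball ht s)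
  have : 0 < 1 - ‖t‖ ^ 2 := by nlinarith [norm_nonneg t]
  unfold kernel
  positivity

theorem continuous_kernel (ht : t ∈ ball (0 : ℂ) 1) : Continuous (kernel t) := by
  unfold kernel
  refine continuous_const.div (by fun_prop) fun s => ?_
  exact pow_ne_zero _ (norm_ne_zero_iff.2 (sub_ne_zero_of_mem_ball ht s))

theorem exists_kernel_bounds (ht : t ∈ ball (0 : ℂ) 1) :
    ∃ a b : ℝ, 0 < a ∧ 0 < b ∧ ∀ s, a ≤ kernel t s ∧ kernel t s ≤ b := by
  obtain ⟨x, -, hx⟩ := isCompact_univ.exists_isMinOn univ_nonempty (continuous_kernel ht).continuousOn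
  obtain ⟨y, -, hy⟩ := isCompact_univ.exists_isMaxOn univ_nonempty (continuous_kernel ht).continuousOn
  exact ⟨kernel t x, kernel t y, kernel_pos ht x, kernel_pos ht y,
    fun s => ⟨hx (mem_univ s), hy (mem_univ s)⟩⟩

theorem integrable_kernel_smul {E : Type*} [NormedAddCommGroup E] [NormedSpace ℝ E]
    (ht : t ∈ ball (0 : ℂ) 1) {h : Circle → E} (hh : Integrable h arcMeasure) :
    Integrable (fun s => kernel t s • h s) arcMeasure := by
  obtain ⟨a, b, ha, hb, hab⟩ := exists_kernel_bounds ht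
  refine hh.bdd_smul b (continuous_kernel ht).aestronglyMeasurable (ae_of_all _ fun s => ?_)
  rw [Real.norm_of_nonneg (kernel_pos ht s).le]
  exact (hab s).2

/-- The Poisson integral formula for the disc algebra. -/
theorem poisson_of_diffContOnCl {E : Type*} [NormedAddCommGroup E] [NormedSpace ℂ E]
    [CompleteSpace E] {G : ℂ → E} (hG : DiffContOnCl ℂ G (ball 0 1)) (ht : t ∈ ball (0 : ℂ) 1) :
    poisson (fun s => G s) t = G t := by
  have hc : Continuous fun s : Circle => G s := by
    have := hG.continuousOn
    rw [closure_ball _ one_ne_zero] at this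
    exact this.comp_continuous continuous_subtype_val (fun s => by simp [Circle.norm_coe])
  rw [← hG.circleAverage_poissonKernel_smul ht, poisson_def]
  refine integral_arcMeasure
    (integrable_kernel_smul ht (continuous_integrable hc)).aestronglyMeasurable fun s => ?_
  simp [poissonKernel_def, kernel, Circle.norm_coe]

theorem integral_kernel (ht : t ∈ ball (0 : ℂ) 1) : ∫ s, kernel t s ∂arcMeasure = 1 := by
  have h := poisson_of_diffContOnCl (G := fun _ => (1 : ℂ)) diffContOnCl_const ht
  rw [poisson_def] at h
  simp only [Complex.real_smul, mul_one] at h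
  have h' : ((∫ s, kernel t s ∂arcMeasure : ℝ) : ℂ) = 1 := integral_ofReal.symm.trans h
  exact_mod_cast h'

theorem integrable_kernel (ht : t ∈ ball (0 : ℂ) 1) : Integrable (kernel t) arcMeasure :=
  continuous_integrable (continuous_kernel ht)

theorem ofReal_mul_circle_mem {r : ℝ} (hr : r ∈ Ioo (0 : ℝ) 1) (s : Circle) :
    (r : ℂ) * s ∈ ball (0 : ℂ) 1 := by
  simp [abs_of_pos hr.1, hr.2, Circle.norm_coe]

/-- For unimodular `s` and `x` one has `|x - r s| = |s - r x|`. This lets Tonelli's theorem bound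
dilates in `L^q`. -/
theorem kernel_symm {r : ℝ} (s x : Circle) : kernel (r * s) x = kernel (r * x) s := by
  unfold kernel
  have h1 : ‖(r : ℂ) * s‖ = ‖(r : ℂ) * x‖ := by simp [Circle.norm_coe]
  have h2 : ‖(x : ℂ) - r * s‖ ^ 2 = ‖(s : ℂ) - r * x‖ ^ 2 := by
    simp only [← Complex.normSq_eq_norm_sq, Complex.normSq_sub]
    simp only [Complex.normSq_eq_norm_sq, Circle.norm_coe, map_mul, Complex.conj_ofReal,
      Complex.mul_re, Complex.mul_im, Complex.ofReal_re, Complex.ofReal_im, Complex.conj_re,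
      Complex.conj_im]
    ring
  rw [h1, h2]

/-- On the circle `|x - s|² = 2 - 2 Re (s̄ x)`, and the Poisson integral of `s̄ z` at `r s` is `r`.
This second moment tends to 0 as `r → 1`, so the kernel concentrates at `s`. -/
theorem integral_kernel_mul_sq {r : ℝ} (hr : r ∈ Ioo (0 : ℝ) 1) (s : Circle) :
    ∫ x, kernel (r * s) x * ‖(x : ℂ) - s‖ ^ 2 ∂arcMeasure = 2 - 2 * r := by
  have ht := ofReal_mul_circle_mem hr s
  have h := poisson_of_diffContOnCl (G := fun z : ℂ => (starRingEnd ℂ s) * z)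
    (by fun_prop : Differentiable ℂ fun z : ℂ => (starRingEnd ℂ s) * z).diffContOnCl ht
  have hs : (starRingEnd ℂ (s : ℂ)) * s = 1 := by
    rw [mul_comm, Complex.mul_conj, Complex.normSq_eq_norm_sq, Circle.norm_coe]
    norm_num
  have hint : Integrable (fun x : Circle => kernel (r * s) x • ((starRingEnd ℂ s) * (x : ℂ)))
    arcMeasure := integrable_kernel_smul ht (continuous_integrable (by fun_prop))
  have h2 := congrArg Complex.re h
  rw [poisson_def, ← RCLike.re_eq_complex_re, ← integral_re hint] at h2
  have h3 : ∀ x : Circle, kernel (r * s) x * ‖(x : ℂ) - s‖ ^ 2 =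
      2 * kernel (r * s) x -
        2 * RCLike.re (kernel (r * s) x • ((starRingEnd ℂ s) * (x : ℂ))) := by
    intro x
    simp only [← Complex.normSq_eq_norm_sq, Complex.normSq_sub]
    simp only [Complex.normSq_eq_norm_sq, Circle.norm_coe, RCLike.re_eq_complex_re,
      Complex.real_smul, Complex.re_ofReal_mul, mul_comm (x : ℂ)]
    ring
  simp only [h3]
  rw [integral_sub ((integrable_kernel ht).const_mul 2) (hint.re.const_mul 2),
    integral_const_mul, integral_const_mul, integral_kernel ht, h2]
  have : (starRingEnd ℂ (s : ℂ)) * (r * s) = r := by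
    rw [mul_left_comm, hs, mul_one]
  simp [this]

/-- Poisson integrals of continuous functions attain their boundary values uniformly. -/
theorem exists_forall_norm_poisson_sub_le {E : Type*} [NormedAddCommGroup E] [NormedSpace ℝ E]
    [CompleteSpace E]
    {h : Circle → E} (hh : Continuous h) {ε : ℝ} (hε : 0 < ε) :
    ∃ r₀ < 1, ∀ r ∈ Ioo (0 : ℝ) 1, r₀ < r → ∀ s : Circle, ‖poisson h (r * s) - h s‖ ≤ ε := by
  obtain ⟨δ, hδ, hδh⟩ := Metric.uniformContinuous_iff.1
    (CompactSpace.uniformContinuous_of_continuous hh) (ε / 2) (half_pos hε)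
  obtain ⟨x₀, -, hx₀⟩ := isCompact_univ.exists_isMaxOn univ_nonempty hh.norm.continuousOn
  let M := ‖h x₀‖
  have hM : ∀ x, ‖h x‖ ≤ M := fun x => hx₀ (mem_univ x)
  have hM0 : 0 ≤ M := norm_nonneg _
  -- A Chebyshev-type bound: uniform continuity handles `x` near `s`, and far away `2 M` is absorbed
  -- by the quadratic term, whose Poisson integral is explicit.
  have hb : ∀ x s : Circle, ‖h x - h s‖ ≤ ε / 2 + 2 * M / δ ^ 2 * ‖(x : ℂ) - s‖ ^ 2 := by
    intro x s
    rcases lt_or_ge (dist x s) δ with hd | hd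
    · have := (hδh hd).le
      rw [dist_eq_norm] at this
      have : 0 ≤ 2 * M / δ ^ 2 * ‖(x : ℂ) - s‖ ^ 2 := by positivity
      linarith
    · have h1 : δ ≤ ‖(x : ℂ) - s‖ := by
        rwa [← Complex.dist_eq]
      have h2 : 2 * M ≤ 2 * M / δ ^ 2 * ‖(x : ℂ) - s‖ ^ 2 := by
        calc 2 * M = 2 * M / δ ^ 2 * δ ^ 2 := by field_simp
          _ ≤ _ := by gcongr
      linarith [norm_sub_le (h x) (h s), hM x, hM s]
  -- For larger `r` the quadratic term contributes `(1 - r) · 4 M / δ² < ε / 2`; the `+ 1` guards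
  -- against `M = 0`.
  refine ⟨1 - ε / 2 / (4 * M / δ ^ 2 + 1), by
    have : 0 < ε / 2 / (4 * M / δ ^ 2 + 1) := by positivity
    linarith, fun r hr hr₀ s => ?_⟩
  have ht := ofReal_mul_circle_mem hr s
  have hc : Continuous fun x : Circle => ‖(x : ℂ) - s‖ ^ 2 := by fun_prop
  have hi : Integrable (fun x : Circle => kernel (r * s) x * ‖(x : ℂ) - s‖ ^ 2) arcMeasure :=
    integrable_kernel_smul ht (continuous_integrable hc)
  have h1 : poisson h (r * s) - h s = ∫ x, kernel (r * s) x • (h x - h s) ∂arcMeasure := by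
    simp only [smul_sub]
    rw [integral_sub (integrable_kernel_smul ht (continuous_integrable hh))
      ((integrable_kernel ht).smul_const _), integral_smul_const, integral_kernel ht, one_smul,
      poisson_def]
  rw [h1]
  refine (norm_integral_le_integral_norm _).trans ?_
  calc ∫ x, ‖kernel (r * s) x • (h x - h s)‖ ∂arcMeasure
      ≤ ∫ x, (ε / 2 * kernel (r * s) x +
          2 * M / δ ^ 2 * (kernel (r * s) x * ‖(x : ℂ) - s‖ ^ 2)) ∂arcMeasure := by
        refine integral_mono (integrable_kernel_smul ht
          (continuous_integrable (by fun_prop))).norm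
          (((integrable_kernel ht).const_mul _).add (hi.const_mul _)) fun x => ?_
        simp only [norm_smul, Real.norm_of_nonneg (kernel_pos ht x).le]
        nlinarith [hb x s, kernel_pos ht x]
    _ = ε / 2 + 2 * M / δ ^ 2 * (2 - 2 * r) := by
        rw [integral_add ((integrable_kernel ht).const_mul _) (hi.const_mul _),
          integral_const_mul, integral_const_mul, integral_kernel ht,
          integral_kernel_mul_sq hr, mul_one]
    _ ≤ ε := by
        have h2 : (1 - r) * (4 * M / δ ^ 2 + 1) < ε / 2 := by
          rw [← lt_div_iff₀ (by positivity)]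
          linarith
        have h3 : 2 * M / δ ^ 2 * (2 - 2 * r) = (1 - r) * (4 * M / δ ^ 2) := by ring
        rw [h3]
        nlinarith [hr.2]

theorem poisson_mono_ae {h g : Circle → ℝ} (ht : t ∈ ball (0 : ℂ) 1)
    (hh : Integrable h arcMeasure) (hg : Integrable g arcMeasure)
    (hhg : ∀ᵐ s ∂arcMeasure, h s ≤ g s) : poisson h t ≤ poisson g t :=
  integral_mono_ae (integrable_kernel_smul ht hh) (integrable_kernel_smul ht hg)
    (hhg.mono fun s hs => mul_le_mul_of_nonneg_left hs (kernel_pos ht s).le)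

theorem poisson_sub {E : Type*} [NormedAddCommGroup E] [NormedSpace ℝ E] {h g : Circle → E}
    (ht : t ∈ ball (0 : ℂ) 1) (hh : Integrable h arcMeasure) (hg : Integrable g arcMeasure) :
    poisson (fun s => h s - g s) t = poisson h t - poisson g t := by
  simp only [poisson_def, smul_sub]
  exact integral_sub (integrable_kernel_smul ht hh) (integrable_kernel_smul ht hg)

/-- Harnack's inequality for Poisson integrals of nonnegative functions. -/
theorem exists_poisson_le_mul {t₀ : ℂ} (ht : t ∈ ball (0 : ℂ) 1) (ht₀ : t₀ ∈ ball (0 : ℂ) 1) :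
    ∃ C > 0, ∀ h : Circle → ℝ, Integrable h arcMeasure → (∀ᵐ s ∂arcMeasure, 0 ≤ h s) →
      poisson h t ≤ C * poisson h t₀ := by
  obtain ⟨a, b, ha, hb, hab⟩ := exists_kernel_bounds ht
  obtain ⟨a', b', ha', hb', hab'⟩ := exists_kernel_bounds ht₀
  refine ⟨b / a', by positivity, fun h hh h0 => ?_⟩
  rw [poisson_def, poisson_def, ← integral_const_mul]
  refine integral_mono_ae (integrable_kernel_smul ht hh)
    ((integrable_kernel_smul ht₀ hh).const_mul _) (h0.mono fun s hs => ?_)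
  simp only [smul_eq_mul, ← mul_assoc]
  gcongr
  rw [div_mul_eq_mul_div, le_div_iff₀ ha']
  exact mul_le_mul (hab s).2 (hab' s).1 ha'.le hb.le

end DiscInterpolation

/-! ### Dilates of Poisson integrals in `L^q` -/

namespace DiscInterpolation

section Dilates

variable {E : Type*} [NormedAddCommGroup E] [NormedSpace ℝ E] {q : ℝ≥0∞} {h : Circle → E} {r : ℝ}

theorem measurable_kernel_dilate (r : ℝ) :
    Measurable fun x : Circle × Circle => kernel (r * x.1) x.2 := by
  unfold kernel
  have hc : Measurable fun s : Circle => (s : ℂ) :=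
    (by fun_prop : Continuous fun s : Circle => (s : ℂ)).measurable
  have h1 : Measurable fun x : Circle × Circle => (x.1 : ℂ) := hc.comp measurable_fst
  have h2 : Measurable fun x : Circle × Circle => (x.2 : ℂ) := hc.comp measurable_snd
  fun_prop

theorem aestronglyMeasurable_poisson_dilate (hh : AEStronglyMeasurable h arcMeasure) (r : ℝ) :
    AEStronglyMeasurable (fun s : Circle => poisson h (r * s)) arcMeasure :=
  AEStronglyMeasurable.integral_prod_right'
    (f := fun x : Circle × Circle => kernel (r * x.1) x.2 • h x.2)
    ((measurable_kernel_dilate r).aestronglyMeasurable.smul hh.comp_snd)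

theorem lintegral_kernel {t : ℂ} (ht : t ∈ ball (0 : ℂ) 1) :
    ∫⁻ s, ENNReal.ofReal (kernel t s) ∂arcMeasure = 1 := by
  rw [← ofReal_integral_eq_lintegral_ofReal (integrable_kernel ht)
    (ae_of_all _ fun s => (kernel_pos ht s).le), integral_kernel ht, ENNReal.ofReal_one]

/-- Jensen's inequality, in the form that `L^q` norms increase with the exponent for the probability
measure with density the Poisson kernel. -/
theorem enorm_poisson_rpow_le {t : ℂ} (ht : t ∈ ball (0 : ℂ) 1) (hq : 1 ≤ q) (hq' : q ≠ ∞)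
    (hh : AEStronglyMeasurable h arcMeasure) :
    ‖poisson h t‖ₑ ^ q.toReal ≤
      ∫⁻ x, ENNReal.ofReal (kernel t x) * ‖h x‖ₑ ^ q.toReal ∂arcMeasure := by
  have hk : Measurable fun x => ENNReal.ofReal (kernel t x) :=
    (continuous_kernel ht).measurable.ennreal_ofReal
  let ν : Measure Circle := arcMeasure.withDensity fun x => ENNReal.ofReal (kernel t x)
  have : IsProbabilityMeasure ν := ⟨by
    rw [withDensity_apply _ .univ, Measure.restrict_univ, lintegral_kernel ht]⟩
  have hν : ν ≪ arcMeasure := withDensity_absolutelyContinuous _ _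
  have hhν : AEStronglyMeasurable h ν := hh.mono_ac hν
  have h0 : q ≠ 0 := (zero_lt_one.trans_le hq).ne'
  have hq0 : 0 < q.toReal := ENNReal.toReal_pos h0 hq'
  have h1 : ‖poisson h t‖ₑ ≤ eLpNorm h 1 ν := by
    rw [eLpNorm_one_eq_lintegral_enorm,
      lintegral_withDensity_eq_lintegral_mul₀ hk.aemeasurable hh.enorm]
    refine (enorm_integral_le_lintegral_enorm _).trans (lintegral_mono fun x => ?_)
    change ‖kernel t x • h x‖ₑ ≤ _
    rw [enorm_smul, Real.enorm_of_nonneg (kernel_pos ht x).le]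
    rfl
  calc ‖poisson h t‖ₑ ^ q.toReal ≤ eLpNorm h q ν ^ q.toReal := by
        gcongr
        exact h1.trans (eLpNorm_le_eLpNorm_of_exponent_le hq hhν)
    _ = ∫⁻ x, ‖h x‖ₑ ^ q.toReal ∂ν := by
        rw [eLpNorm_eq_lintegral_rpow_enorm_toReal h0 hq', ← ENNReal.rpow_mul,
          one_div_mul_cancel hq0.ne', ENNReal.rpow_one]
    _ = _ := by
        rw [lintegral_withDensity_eq_lintegral_mul₀ hk.aemeasurable (hh.enorm.pow_const _)]
        rfl

/-- Dilates of Poisson integrals are bounded in `L^q` by the boundary function. -/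
theorem eLpNorm_poisson_dilate_le (hr : r ∈ Ioo (0 : ℝ) 1) (hq : 1 ≤ q) (hq' : q ≠ ∞)
    (hh : AEStronglyMeasurable h arcMeasure) :
    eLpNorm (fun s : Circle => poisson h (r * s)) q arcMeasure ≤ eLpNorm h q arcMeasure := by
  have h0 : q ≠ 0 := (zero_lt_one.trans_le hq).ne'
  have hq0 : 0 < q.toReal := ENNReal.toReal_pos h0 hq'
  rw [eLpNorm_eq_lintegral_rpow_enorm_toReal h0 hq', eLpNorm_eq_lintegral_rpow_enorm_toReal h0 hq']
  refine ENNReal.rpow_le_rpow ?_ (by positivity)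
  have hm : AEMeasurable (Function.uncurry fun s x : Circle =>
      ENNReal.ofReal (kernel (r * s) x) * ‖h x‖ₑ ^ q.toReal) (arcMeasure.prod arcMeasure) :=
    (measurable_kernel_dilate r).ennreal_ofReal.aemeasurable.mul
      (hh.comp_snd.enorm.pow_const _)
  calc ∫⁻ s : Circle, ‖poisson h (r * s)‖ₑ ^ q.toReal ∂arcMeasure
      ≤ ∫⁻ s : Circle, ∫⁻ x, ENNReal.ofReal (kernel (r * s) x) * ‖h x‖ₑ ^ q.toReal
          ∂arcMeasure ∂arcMeasure :=
        lintegral_mono fun s => enorm_poisson_rpow_le (ofReal_mul_circle_mem hr s) hq hq' hh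
    _ = ∫⁻ x, ∫⁻ s : Circle, ENNReal.ofReal (kernel (r * s) x) * ‖h x‖ₑ ^ q.toReal
          ∂arcMeasure ∂arcMeasure := lintegral_lintegral_swap hm
    _ = ∫⁻ x, ‖h x‖ₑ ^ q.toReal ∂arcMeasure := by
        refine lintegral_congr fun x => ?_
        -- By symmetry the kernel also has total mass one in the variable `s`.
        simp_rw [kernel_symm _ x]
        rw [lintegral_mul_const _
          (continuous_kernel (ofReal_mul_circle_mem hr x)).measurable.ennreal_ofReal,
          lintegral_kernel (ofReal_mul_circle_mem hr x), one_mul]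

/-- Dilates of Poisson integrals converge in `L^q` to the boundary function. -/
theorem tendsto_eLpNorm_poisson_dilate_sub [CompleteSpace E] (hq : 1 ≤ q) (hq' : q ≠ ∞)
    (hh : MemLp h q arcMeasure) {ρ : ℕ → ℝ} (hρ : ∀ k, ρ k ∈ Ioo (0 : ℝ) 1)
    (hlim : Tendsto ρ atTop (𝓝 1)) :
    Tendsto (fun k => eLpNorm ((fun s : Circle => poisson h (ρ k * s)) - h) q arcMeasure)
      atTop (𝓝 0) := by
  rw [ENNReal.tendsto_nhds_zero]
  intro ε hε
  have hε3 : ε / 3 ≠ 0 := (ENNReal.div_pos hε.ne' (by simp)).ne'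
  obtain ⟨g, hg, hgq⟩ := hh.exists_boundedContinuous_eLpNorm_sub_le hq' hε3
  obtain ⟨η, hη0, hη⟩ := ENNReal.lt_iff_exists_nnreal_btwn.1 (pos_iff_ne_zero.2 hε3)
  obtain ⟨r₀, hr₀, H⟩ := exists_forall_norm_poisson_sub_le g.continuous (ε := η)
    (by exact_mod_cast hη0)
  filter_upwards [hlim.eventually (lt_mem_nhds hr₀)] with k hk
  have hgi : Integrable g arcMeasure := continuous_integrable g.continuous
  have hhi : Integrable h arcMeasure := hh.integrable hq
  -- With `g` continuous and `L^q`-close to `h`: contractivity controls `P[h - g]`, uniform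
  -- convergence controls `P[g] - g`, and the choice of `g` controls the rest.
  have e : ((fun s : Circle => poisson h (ρ k * s)) - h) =
      ((fun s : Circle => poisson (fun x => h x - g x) (ρ k * s)) +
        fun s : Circle => poisson g (ρ k * s) - g s) - (h - ⇑g) := by
    ext s
    simp only [Pi.sub_apply, Pi.add_apply]
    rw [poisson_sub (ofReal_mul_circle_mem (hρ k) s) hhi hgi]
    abel
  have m1 := aestronglyMeasurable_poisson_dilate (hhi.sub hgi).aestronglyMeasurable (ρ k)
  have m2 := (aestronglyMeasurable_poisson_dilate hgi.aestronglyMeasurable (ρ k)).sub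
    hgi.aestronglyMeasurable
  have m3 := (hhi.sub hgi).aestronglyMeasurable
  have b1 := (eLpNorm_poisson_dilate_le (hρ k) hq hq' m3).trans hg
  have b2 : eLpNorm (fun s : Circle => poisson g (ρ k * s) - g s) q arcMeasure ≤ ε / 3 := by
    refine (eLpNorm_le_of_ae_bound (C := η) (ae_of_all _ (H (ρ k) (hρ k) hk))).trans ?_
    simpa using hη.le
  rw [e]
  calc _ ≤ eLpNorm ((fun s : Circle => poisson (fun x => h x - g x) (ρ k * s)) +
          fun s : Circle => poisson g (ρ k * s) - g s) q arcMeasure +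
          eLpNorm (h - ⇑g) q arcMeasure := eLpNorm_sub_le (m1.add m2) m3 hq
    _ ≤ (ε / 3 + ε / 3) + ε / 3 := by
        gcongr
        exact (eLpNorm_add_le m1 m2 hq).trans (add_le_add b1 b2)
    _ = ε := ENNReal.add_thirds ε

/-- A substitute for Fatou's radial limit theorem: `L¹` convergence gives almost everywhere
convergence along a subsequence, which suffices for bounding a limit from above by a `limsup`. -/
theorem exists_seq_tendsto_ae_poisson [CompleteSpace E] (hh : Integrable h arcMeasure)
    {ρ : ℕ → ℝ} (hρ : ∀ k, ρ k ∈ Ioo (0 : ℝ) 1) (hlim : Tendsto ρ atTop (𝓝 1)) :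
    ∃ ns : ℕ → ℕ, StrictMono ns ∧
      ∀ᵐ s : Circle ∂arcMeasure, Tendsto (fun k => poisson h (ρ (ns k) * s)) atTop (𝓝 (h s)) :=
  (tendstoInMeasure_of_tendsto_eLpNorm one_ne_zero
    (fun k => aestronglyMeasurable_poisson_dilate hh.aestronglyMeasurable (ρ k))
    hh.aestronglyMeasurable (tendsto_eLpNorm_poisson_dilate_sub le_rfl ENNReal.one_ne_top
      (memLp_one_iff_integrable.2 hh) hρ hlim)).exists_seq_tendsto_ae

/-- Poisson integrals at a fixed point depend continuously on the boundary function in `L^1`. -/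
theorem tendsto_poisson_of_tendsto_eLpNorm {t : ℂ} (ht : t ∈ ball (0 : ℂ) 1) {a : ℕ → Circle → E}
    (ha : ∀ k, Integrable (a k) arcMeasure) (hh : Integrable h arcMeasure)
    (hlim : Tendsto (fun k => eLpNorm (fun s => a k s - h s) 1 arcMeasure) atTop (𝓝 0)) :
    Tendsto (fun k => poisson (a k) t) atTop (𝓝 (poisson h t)) := by
  obtain ⟨_, b, -, hb, hab⟩ := exists_kernel_bounds ht
  rw [tendsto_iff_edist_tendsto_0]
  have hlim' := ENNReal.Tendsto.const_mul (a := ENNReal.ofReal b) hlim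
    (Or.inr ENNReal.ofReal_ne_top)
  rw [mul_zero] at hlim'
  refine tendsto_of_tendsto_of_tendsto_of_le_of_le tendsto_const_nhds hlim' (fun _ => zero_le) ?_
  intro k
  simp only
  rw [edist_eq_enorm_sub, ← poisson_sub ht (ha k) hh, eLpNorm_one_eq_lintegral_enorm,
    ← lintegral_const_mul' _ _ ENNReal.ofReal_ne_top]
  refine (enorm_integral_le_lintegral_enorm _).trans (lintegral_mono fun x => ?_)
  change ‖kernel t x • _‖ₑ ≤ _
  rw [enorm_smul, Real.enorm_of_nonneg (kernel_pos ht x).le]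
  gcongr
  exact (hab x).2

end Dilates

end DiscInterpolation

/-! ### Harmonicity and holomorphy of Poisson integrals -/

namespace DiscInterpolation

section Analytic

variable {E : Type*} [NormedAddCommGroup E] [NormedSpace ℂ E] [CompleteSpace E] {t : ℂ}

theorem continuous_herglotz (ht : t ∈ ball (0 : ℂ) 1) :
    Continuous fun s : Circle => herglotzRieszKernel 0 t s := by
  simp only [herglotzRieszKernel_def, sub_zero]
  exact (by fun_prop : Continuous fun s : Circle => (s : ℂ) + t).div (by fun_prop)
    (sub_ne_zero_of_mem_ball ht)

omit [CompleteSpace E] in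
theorem integrable_continuous_smul {k : Circle → ℂ} (hk : Continuous k) {h : Circle → E}
    (hh : Integrable h arcMeasure) : Integrable (fun s => k s • h s) arcMeasure := by
  obtain ⟨y, -, hy⟩ := isCompact_univ.exists_isMaxOn univ_nonempty hk.norm.continuousOn
  exact hh.bdd_smul (‖k y‖) hk.aestronglyMeasurable (ae_of_all _ fun s => hy (mem_univ s))

theorem analyticOnNhd_integral_herglotz {h : Circle → E} (hh : Integrable h arcMeasure) :
    AnalyticOnNhd ℂ (fun t => ∫ s : Circle, herglotzRieszKernel 0 t s • h s ∂arcMeasure)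
      (ball 0 1) := by
  -- Circle averages take functions on `ℂ`, so `h` is extended by making it constant on rays.
  have hg : ∀ s : Circle, (fun z : ℂ => h (Circle.exp z.arg)) s = h s := fun s => by
    simp only [Circle.exp_arg]
  refine (analyticOnNhd_circleAverage_herglotzRieszKernel_smul
    (circleIntegrable_of_integrable hh (g := fun z : ℂ => h (Circle.exp z.arg)) hg)).congr isOpen_ball fun t ht => ?_
  refine (integral_arcMeasure
    (integrable_continuous_smul (continuous_herglotz ht) hh).aestronglyMeasurable fun s => ?_).symm
  simp only [Circle.exp_arg]

theorem kernel_eq_re_herglotz (t : ℂ) (s : Circle) :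
    kernel t s = (herglotzRieszKernel 0 t s).re := by
  have := congrFun (poissonKernel_eq_re_herglotzRieszKernel (c := 0) (w := t)) s
  rw [Function.comp_apply] at this
  rw [← this]
  simp [poissonKernel_def, kernel, Circle.norm_coe]

theorem harmonicOnNhd_poisson {h : Circle → ℝ} (hh : Integrable h arcMeasure) :
    InnerProductSpace.HarmonicOnNhd (poisson h) (ball 0 1) := by
  have hc : Integrable (fun s => (h s : ℂ)) arcMeasure := hh.ofReal
  intro t ht
  refine (InnerProductSpace.harmonicAt_congr_nhds ?_).1
    (analyticOnNhd_integral_herglotz hc t ht).harmonicAt_re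
  filter_upwards [isOpen_ball.mem_nhds ht] with x hx
  rw [← RCLike.re_eq_complex_re,
    ← integral_re (integrable_continuous_smul (continuous_herglotz hx) hc), poisson_def]
  refine integral_congr_ae (ae_of_all _ fun s => ?_)
  simp [kernel_eq_re_herglotz]

theorem one_sub_conj_mul_ne_zero (ht : t ∈ ball (0 : ℂ) 1) {z : ℂ} (hz : ‖z‖ ≤ 1) :
    1 - starRingEnd ℂ t * z ≠ 0 := by
  have h1 : ‖t‖ < 1 := by simpa using ht
  rw [sub_ne_zero]
  intro h
  have := congrArg norm h
  rw [norm_one, norm_mul, RCLike.norm_conj] at this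
  nlinarith [norm_nonneg z, norm_nonneg t]

/-- Using `s̄ = 1 / s`, the kernel becomes a rational function of `s`, comparable with functions of
the disc algebra. -/
theorem coe_kernel (ht : t ∈ ball (0 : ℂ) 1) (s : Circle) : (kernel t s : ℂ) =
    s * (1 - t * starRingEnd ℂ t) / ((s - t) * (1 - starRingEnd ℂ t * s)) := by
  have h1 := sub_ne_zero_of_mem_ball ht s
  have h2 := one_sub_conj_mul_ne_zero ht (Circle.norm_coe s).le
  have h3 : (s : ℂ) * starRingEnd ℂ s = 1 := by
    rw [Complex.mul_conj, Complex.normSq_eq_norm_sq, Circle.norm_coe]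
    norm_num
  have h4 : ((‖(s : ℂ) - t‖ ^ 2 : ℝ) : ℂ) = (s - t) * (starRingEnd ℂ s - starRingEnd ℂ t) := by
    rw [← Complex.normSq_eq_norm_sq, ← Complex.mul_conj, map_sub]
  have h5 : ((‖t‖ ^ 2 : ℝ) : ℂ) = t * starRingEnd ℂ t := by
    rw [← Complex.normSq_eq_norm_sq, ← Complex.mul_conj]
  have h6 : starRingEnd ℂ (s : ℂ) - starRingEnd ℂ t ≠ 0 := by
    rw [← map_sub]
    exact (map_ne_zero _).2 h1
  rw [kernel, Complex.ofReal_div, h4, Complex.ofReal_sub, h5, Complex.ofReal_one,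
    div_eq_div_iff (mul_ne_zero h1 h6) (mul_ne_zero h1 h2)]
  linear_combination (s - t) * (1 - t * starRingEnd ℂ t) * -h3

omit [CompleteSpace E] in
theorem integral_smul_add_smul_add_smul {S : Type*} [MeasurableSpace S] {μ : Measure S} (c : ℂ)
    {u v w : S → E} (hu : Integrable u μ) (hv : Integrable v μ) (hw : Integrable w μ) :
    ∫ s, (c • u s + (c • v s + c • w s)) ∂μ =
      c • ∫ s, u s ∂μ + (c • ∫ s, v s ∂μ + c • ∫ s, w s ∂μ) := by
  have hu' : Integrable (fun s => c • u s) μ := hu.smul c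
  have hv' : Integrable (fun s => c • v s) μ := hv.smul c
  have hw' : Integrable (fun s => c • w s) μ := hw.smul c
  have hvw : Integrable (fun s => c • v s + c • w s) μ := hv'.add hw'
  rw [integral_add hu' hvw, integral_add hv' hw', integral_smul, integral_smul, integral_smul]

/-- A Poisson integral is holomorphic if its boundary function is annihilated by the functions of
the disc algebra that vanish at a point. -/
theorem differentiableOn_poisson_of_annihilates {t₀ : ℂ} (ht₀ : t₀ ∈ ball (0 : ℂ) 1)
    {h : Circle → E} (hh : Integrable h arcMeasure)
    (hann : ∀ G : ℂ → ℂ, DiffContOnCl ℂ G (ball 0 1) → G t₀ = 0 →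
      poisson (fun s => G s • h s) t₀ = 0) :
    DifferentiableOn ℂ (poisson h) (ball 0 1) := by
  -- The kernel is half the sum of the Herglotz kernel, which is holomorphic in `t`, and its
  -- conjugate `1 + 2 t̄ s / (1 - t̄ s)`. The annihilation hypothesis removes the nonconstant
  -- conjugate term.
  have key : ∀ t ∈ ball (0 : ℂ) 1, poisson h t =
      (1 / 2 : ℂ) • (∫ s : Circle, herglotzRieszKernel 0 t s • h s ∂arcMeasure) +
        (1 / 2 : ℂ) • ∫ s, h s ∂arcMeasure := by
    intro t ht
    -- Chosen so that `kernel t₀ s * G s = 2 t̄ s / (1 - t̄ s)`: on the circle, the first three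
    -- factors equal `s / kernel t₀ s`, and they bring the zero at `t₀`.
    let G : ℂ → ℂ := fun z => (z - t₀) * (1 - starRingEnd ℂ t₀ * z) *
      (1 - t₀ * starRingEnd ℂ t₀)⁻¹ * (2 * starRingEnd ℂ t) / (1 - starRingEnd ℂ t * z)
    have hden : ∀ z ∈ closedBall (0 : ℂ) 1, 1 - starRingEnd ℂ t * z ≠ 0 := fun z hz =>
      one_sub_conj_mul_ne_zero ht (by simpa using hz)
    have hG : DiffContOnCl ℂ G (ball 0 1) := by
      refine DifferentiableOn.diffContOnCl ?_
      rw [closure_ball _ one_ne_zero]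
      exact DifferentiableOn.fun_div (by fun_prop) (by fun_prop) hden
    have hGt : G t₀ = 0 := by simp [G]
    have h1 := hann G hG hGt
    have hpt : ∀ s : Circle, kernel t₀ s • G s • h s =
        (2 * starRingEnd ℂ t * s / (1 - starRingEnd ℂ t * s)) • h s := by
      intro s
      rw [← Complex.coe_smul, smul_smul, coe_kernel ht₀]
      congr 1
      have e1 := sub_ne_zero_of_mem_ball ht₀ s
      have e2 := one_sub_conj_mul_ne_zero ht₀ (Circle.norm_coe s).le
      have e3 := one_sub_conj_mul_ne_zero ht (Circle.norm_coe s).le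
      rw [mul_comm] at e2 e3
      have e4 : 1 - t₀ * starRingEnd ℂ t₀ ≠ 0 := by
        rw [mul_comm]
        exact one_sub_conj_mul_ne_zero ht₀ (by simpa using (mem_ball.1 ht₀).le)
      simp only [G]
      field_simp
    rw [poisson_def] at h1
    simp only [hpt] at h1
    have hker : ∀ s : Circle, kernel t s • h s =
        (1 / 2 : ℂ) • (herglotzRieszKernel 0 t s • h s) +
        ((1 / 2 : ℂ) • ((2 * starRingEnd ℂ t * s / (1 - starRingEnd ℂ t * s)) • h s) +
          (1 / 2 : ℂ) • h s) := by
      intro s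
      rw [← Complex.coe_smul, smul_smul, smul_smul, ← add_smul, ← add_smul, coe_kernel ht]
      congr 1
      have e1 := sub_ne_zero_of_mem_ball ht s
      have e3 := one_sub_conj_mul_ne_zero ht (Circle.norm_coe s).le
      rw [mul_comm] at e3
      simp only [herglotzRieszKernel_def, sub_zero]
      field_simp
      ring
    have i1 := integrable_continuous_smul (continuous_herglotz ht) hh
    have i2 : Integrable (fun s : Circle =>
        (2 * starRingEnd ℂ t * s / (1 - starRingEnd ℂ t * s)) • h s) arcMeasure :=
      integrable_continuous_smul
        ((by fun_prop : Continuous fun s : Circle => 2 * starRingEnd ℂ t * (s : ℂ)).div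
          (by fun_prop) fun s => one_sub_conj_mul_ne_zero ht (Circle.norm_coe s).le) hh
    refine (integral_congr_ae (ae_of_all _ hker)).trans
      ((integral_smul_add_smul_add_smul (1 / 2 : ℂ) i1 i2 hh).trans ?_)
    rw [h1, smul_zero, zero_add]
  refine DifferentiableOn.congr ?_ key
  exact ((analyticOnNhd_integral_herglotz hh).differentiableOn.const_smul _).add_const _

end Analytic

/-! ### The bilinear pairing -/

section Bil

variable {n : ℕ}

/-- Coordinatewise complex conjugation. -/
def conjVec (z : EuclideanSpace ℂ (Fin n)) : EuclideanSpace ℂ (Fin n) :=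
  WithLp.toLp 2 fun j => starRingEnd ℂ (z j)

@[simp] theorem conjVec_apply (z : EuclideanSpace ℂ (Fin n)) (j : Fin n) :
    conjVec z j = starRingEnd ℂ (z j) := rfl

@[simp] theorem conjVec_conjVec (z : EuclideanSpace ℂ (Fin n)) : conjVec (conjVec z) = z := by
  ext j
  simp

theorem norm_conjVec (z : EuclideanSpace ℂ (Fin n)) : ‖conjVec z‖ = ‖z‖ := by
  simp [EuclideanSpace.norm_eq]

theorem continuous_conjVec : Continuous (conjVec : EuclideanSpace ℂ (Fin n) → _) := by
  unfold conjVec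
  refine (PiLp.continuous_toLp 2 _).comp (continuous_pi fun j => ?_)
  exact Complex.continuous_conj.comp (by fun_prop)

theorem bil_eq_inner (z w : EuclideanSpace ℂ (Fin n)) : bil z w = inner ℂ (conjVec z) w := by
  simp [bil, PiLp.inner_apply, mul_comm]

theorem re_bil (z w : EuclideanSpace ℂ (Fin n)) : (bil z w).re = inner ℝ (conjVec z) w := by
  rw [bil_eq_inner]
  simp [PiLp.inner_apply, Complex.inner]

theorem norm_bil_le (z w : EuclideanSpace ℂ (Fin n)) : ‖bil z w‖ ≤ ‖z‖ * ‖w‖ := by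
  rw [bil_eq_inner, ← norm_conjVec z]
  exact norm_inner_le_norm _ _

theorem bil_comm (z w : EuclideanSpace ℂ (Fin n)) : bil z w = bil w z := by
  simp [bil, mul_comm]

theorem bil_sub_left (z z' w : EuclideanSpace ℂ (Fin n)) :
    bil (z - z') w = bil z w - bil z' w := by
  simp [bil, sub_mul, Finset.sum_sub_distrib]

theorem bil_smul_left (c : ℂ) (z w : EuclideanSpace ℂ (Fin n)) :
    bil (c • z) w = c * bil z w := by
  simp [bil, Finset.mul_sum, mul_assoc]

theorem continuous_bil :
    Continuous fun x : EuclideanSpace ℂ (Fin n) × EuclideanSpace ℂ (Fin n) => bil x.1 x.2 := by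
  unfold bil
  fun_prop

theorem tendsto_bil {α : Type*} {l : Filter α} {a b : α → EuclideanSpace ℂ (Fin n)}
    {z w : EuclideanSpace ℂ (Fin n)} (ha : Tendsto a l (𝓝 z)) (hb : Tendsto b l (𝓝 w)) :
    Tendsto (fun x => bil (a x) (b x)) l (𝓝 (bil z w)) :=
  Tendsto.comp (g := fun x : EuclideanSpace ℂ (Fin n) × EuclideanSpace ℂ (Fin n) => bil x.1 x.2)
    (f := fun x => (a x, b x)) (continuous_bil.tendsto (z, w)) (ha.prodMk_nhds hb)

theorem diffContOnCl_bil {f F : ℂ → EuclideanSpace ℂ (Fin n)} {s : Set ℂ}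
    (hf : DiffContOnCl ℂ f s) (hF : DiffContOnCl ℂ F s) :
    DiffContOnCl ℂ (fun t => bil (f t) (F t)) s := by
  refine ⟨?_, fun t ht => tendsto_bil (hf.continuousOn t ht) (hF.continuousOn t ht)⟩
  unfold bil
  have h1 := differentiableOn_euclidean.1 hf.differentiableOn
  have h2 := differentiableOn_euclidean.1 hF.differentiableOn
  exact DifferentiableOn.fun_sum fun j _ => (h1 j).fun_mul (h2 j)

variable {p q : ℝ≥0∞} {a b : Circle → EuclideanSpace ℂ (Fin n)}

theorem aestronglyMeasurable_bil {μ : Measure Circle} (ha : AEStronglyMeasurable a μ)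
    (hb : AEStronglyMeasurable b μ) : AEStronglyMeasurable (fun s => bil (a s) (b s)) μ :=
  Continuous.comp_aestronglyMeasurable
    (g := fun x : EuclideanSpace ℂ (Fin n) × EuclideanSpace ℂ (Fin n) => bil x.1 x.2)
    (f := fun s => (a s, b s)) continuous_bil (ha.prodMk hb)

theorem eLpNorm_bil_le [q.HolderConjugate p] (ha : AEStronglyMeasurable a arcMeasure)
    (hb : AEStronglyMeasurable b arcMeasure) :
    eLpNorm (fun s => bil (a s) (b s)) 1 arcMeasure ≤
      eLpNorm a q arcMeasure * eLpNorm b p arcMeasure := by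
  have := eLpNorm_le_eLpNorm_mul_eLpNorm_of_nnnorm (p := q) (q := p) (r := 1) ha hb bil 1
    (ae_of_all _ fun s => by rw [one_mul]; exact norm_bil_le _ _)
  simpa using this

theorem integrable_bil [q.HolderConjugate p] (ha : MemLp a q arcMeasure)
    (hb : MemLp b p arcMeasure) : Integrable (fun s => bil (a s) (b s)) arcMeasure := by
  rw [← memLp_one_iff_integrable]
  exact ⟨aestronglyMeasurable_bil ha.1 hb.1,
    (eLpNorm_bil_le ha.1 hb.1).trans_lt (ENNReal.mul_lt_top ha.2 hb.2)⟩

theorem tendsto_poisson_bil [q.HolderConjugate p] {t : ℂ} (ht : t ∈ ball (0 : ℂ) 1)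
    {A : ℕ → Circle → EuclideanSpace ℂ (Fin n)} (hA : ∀ k, MemLp (A k) q arcMeasure)
    (ha : MemLp a q arcMeasure) (hb : MemLp b p arcMeasure)
    (hlim : Tendsto (fun k => eLpNorm (A k - a) q arcMeasure) atTop (𝓝 0)) :
    Tendsto (fun k => poisson (fun s => bil (A k s) (b s)) t) atTop
      (𝓝 (poisson (fun s => bil (a s) (b s)) t)) := by
  refine tendsto_poisson_of_tendsto_eLpNorm ht (fun k => integrable_bil (hA k) hb)
    (integrable_bil ha hb) ?_
  have h1 := ENNReal.Tendsto.mul_const (b := eLpNorm b p arcMeasure) hlim (Or.inr hb.2.ne)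
  rw [zero_mul] at h1
  refine tendsto_of_tendsto_of_tendsto_of_le_of_le tendsto_const_nhds h1 (fun _ => zero_le) ?_
  intro k
  have := eLpNorm_bil_le (q := q) (p := p) ((hA k).sub ha).1 hb.1
  simpa only [Pi.sub_apply, bil_sub_left] using this

end Bil

/-! ### Products of functions in dual Hardy spaces -/

section Hardy

variable {n : ℕ} {p q : ℝ≥0∞}

theorem IsHardy.diffContOnCl_dilate {f : ℂ → EuclideanSpace ℂ (Fin n)}
    {fb : Circle → EuclideanSpace ℂ (Fin n)} (hf : IsHardy q f fb) {r : ℝ}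
    (hr : r ∈ Ioo (0 : ℝ) 1) : DiffContOnCl ℂ (fun t => f (r * t)) (ball 0 1) := by
  refine DifferentiableOn.diffContOnCl ?_
  rw [closure_ball _ one_ne_zero]
  refine hf.holomorphic.comp (t := ball 0 1) (by fun_prop) fun z hz => ?_
  have hz' : ‖z‖ ≤ 1 := by simpa using hz
  have : ‖(r : ℂ) * z‖ < 1 := by
    rw [norm_mul, Complex.norm_real, Real.norm_of_nonneg hr.1.le]
    nlinarith [hr.1, hr.2, norm_nonneg z]
  simpa using this

theorem _root_.DiffContOnCl.continuous_circle {E : Type*} [NormedAddCommGroup E] [NormedSpace ℂ E]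
    {G : ℂ → E} (hG : DiffContOnCl ℂ G (ball 0 1)) : Continuous fun s : Circle => G s := by
  have := hG.continuousOn
  rw [closure_ball _ one_ne_zero] at this
  exact this.comp_continuous continuous_subtype_val (fun s => by simp [Circle.norm_coe])

theorem continuous_memLp {E : Type*} [NormedAddCommGroup E] {h : Circle → E}
    (hh : Continuous h) (q : ℝ≥0∞) : MemLp h q arcMeasure := by
  obtain ⟨y, -, hy⟩ := isCompact_univ.exists_isMaxOn univ_nonempty hh.norm.continuousOn
  exact MemLp.of_bound (continuous_integrable hh).aestronglyMeasurable ‖h y‖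
    (ae_of_all _ fun s => hy (mem_univ s))

theorem exists_seq_Ioo_tendsto_one :
    ∃ ρ : ℕ → ℝ, (∀ k, ρ k ∈ Ioo (0 : ℝ) 1) ∧ Tendsto ρ atTop (𝓝 1) := by
  obtain ⟨u, -, hu, hlim⟩ := exists_seq_strictMono_tendsto' (zero_lt_one' ℝ)
  exact ⟨u, hu, hlim⟩

/-- The exponent `r` is kept separate from `q` so that `q = ∞` is covered, with convergence in a
weaker norm. -/
theorem IsHardy.tendsto_eLpNorm_dilate {f : ℂ → EuclideanSpace ℂ (Fin n)}
    {fb : Circle → EuclideanSpace ℂ (Fin n)} (hf : IsHardy q f fb) {r : ℝ≥0∞} (hr : 1 ≤ r)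
    (hr' : r ≠ ∞) (hrq : r ≤ q) {ρ : ℕ → ℝ} (hρ : ∀ k, ρ k ∈ Ioo (0 : ℝ) 1)
    (hlim : Tendsto ρ atTop (𝓝 1)) :
    Tendsto (fun k => eLpNorm ((fun s : Circle => f (ρ k * s)) - fb) r arcMeasure)
      atTop (𝓝 0) := by
  have := tendsto_eLpNorm_poisson_dilate_sub hr hr' (hf.memLp.mono_exponent hrq) hρ hlim
  refine this.congr fun k => ?_
  congr 2
  ext1 s
  exact (hf.eq_poisson _ (ofReal_mul_circle_mem (hρ k) s)).symm

/-- The product of functions in dual Hardy spaces is the Poisson integral of its boundary values. -/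
theorem IsHardy.poisson_bil [hpq : q.HolderConjugate p] (hq' : q ≠ ∞)
    {f F : ℂ → EuclideanSpace ℂ (Fin n)} {fb Fb : Circle → EuclideanSpace ℂ (Fin n)}
    (hf : IsHardy q f fb) (hF : IsHardy p F Fb) {t : ℂ} (ht : t ∈ ball (0 : ℂ) 1) :
    poisson (fun s => bil (fb s) (Fb s)) t = bil (f t) (F t) := by
  have hq : 1 ≤ q := ENNReal.HolderConjugate.one_le q p
  have hp : 1 ≤ p := ENNReal.HolderConjugate.one_le p q
  obtain ⟨ρ, hρ, hlim⟩ := exists_seq_Ioo_tendsto_one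
  have hpt : ∀ {g : ℂ → EuclideanSpace ℂ (Fin n)}, DifferentiableOn ℂ g (ball 0 1) →
      Tendsto (fun k => g (ρ k * t)) atTop (𝓝 (g t)) := by
    intro g hg
    refine ((hg.differentiableAt (isOpen_ball.mem_nhds ht)).continuousAt.tendsto).comp ?_
    have : Tendsto (fun k => (ρ k : ℂ) * t) atTop (𝓝 (((1 : ℝ) : ℂ) * t)) :=
      ((Complex.continuous_ofReal.tendsto _).comp hlim).mul_const t
    simpa using this
  -- The limits are taken one at a time because `p` may be `∞`. With `f` dilated, hence bounded,
  -- `L¹` convergence of the dilates of `F` is enough; afterwards the dilates of `f` converge in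
  -- `L^q` against `Fb ∈ L^p`.
  have h1 : ∀ r ∈ Ioo (0 : ℝ) 1,
      poisson (fun s : Circle => bil (f (r * s)) (Fb s)) t = bil (f (r * t)) (F t) := by
    intro r hr
    have hfr := hf.diffContOnCl_dilate hr
    have e1 : ∀ k, poisson (fun s : Circle => bil (F (ρ k * s)) (f (r * s))) t =
        bil (F (ρ k * t)) (f (r * t)) := fun k =>
      poisson_of_diffContOnCl (diffContOnCl_bil (hF.diffContOnCl_dilate (hρ k)) hfr) ht
    have e2 : Tendsto (fun k => poisson (fun s : Circle => bil (F (ρ k * s)) (f (r * s))) t) atTop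
        (𝓝 (poisson (fun s : Circle => bil (Fb s) (f (r * s))) t)) :=
      tendsto_poisson_bil (q := 1) (p := ∞) ht
        (fun k => continuous_memLp (hF.diffContOnCl_dilate (hρ k)).continuous_circle 1)
        (hF.memLp.mono_exponent hp) (continuous_memLp hfr.continuous_circle ∞)
        (hF.tendsto_eLpNorm_dilate le_rfl ENNReal.one_ne_top hp hρ hlim)
    simp only [e1] at e2
    have e3 : Tendsto (fun k => bil (F (ρ k * t)) (f (r * t))) atTop
        (𝓝 (bil (F t) (f (r * t)))) :=
      tendsto_bil (hpt hF.holomorphic) tendsto_const_nhds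
    have e4 := tendsto_nhds_unique e2 e3
    simpa only [bil_comm (F t), bil_comm (Fb _)] using e4
  have e2 : Tendsto (fun k => poisson (fun s : Circle => bil (f (ρ k * s)) (Fb s)) t) atTop
      (𝓝 (poisson (fun s : Circle => bil (fb s) (Fb s)) t)) :=
    tendsto_poisson_bil (q := q) (p := p) ht
      (fun k => continuous_memLp (hf.diffContOnCl_dilate (hρ k)).continuous_circle q)
      hf.memLp hF.memLp (hf.tendsto_eLpNorm_dilate hq hq' le_rfl hρ hlim)
  simp only [h1 _ (hρ _)] at e2
  exact tendsto_nhds_unique e2 (tendsto_bil (hpt hf.holomorphic) tendsto_const_nhds)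

end Hardy

end DiscInterpolation

/-! ### The boundary relation and boundary values -/

namespace DiscInterpolation

variable {n : ℕ} {p q : ℝ≥0∞} {φ : Circle → EuclideanSpace ℂ (Fin n) → EReal}

/-- The boundary relation implies the pointwise inequality of boundary values. -/
theorem BoundaryLE.ae_le {f₀ : Circle → ℂ} {f : ℂ → EuclideanSpace ℂ (Fin n)}
    {fb : Circle → EuclideanSpace ℂ (Fin n)} (hle : BoundaryLE (fiberLinear f₀ f) φ)
    (hf₀ : Integrable f₀ arcMeasure) (hq : 1 ≤ q) (hf : IsHardy q f fb) :
    ∀ᵐ s ∂arcMeasure, ∀ z, (((bil (fb s) z).re - (f₀ s).re : ℝ) : EReal) ≤ φ s z := by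
  obtain ⟨ρ, hρ, hlim⟩ := exists_seq_Ioo_tendsto_one
  obtain ⟨ns, hns, h1⟩ := exists_seq_tendsto_ae_poisson (hf.memLp.integrable hq) hρ hlim
  -- A subsequence of the first one, so that `f` and `P[Re f₀]` converge together.
  obtain ⟨ms, hms, h2⟩ := exists_seq_tendsto_ae_poisson (h := fun s => (f₀ s).re) hf₀.re
    (ρ := ρ ∘ ns) (fun k => hρ _) (hlim.comp hns.tendsto_atTop)
  filter_upwards [hle, h1, h2] with s hs h1 h2 z
  let x : ℕ → ℝ × EuclideanSpace ℂ (Fin n) := fun k => (ρ (ns (ms k)), z)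
  have hx : Tendsto x atTop (𝓝[Ioo (0 : ℝ) 1 ×ˢ univ] ((1 : ℝ), z)) := by
    refine tendsto_nhdsWithin_iff.2 ⟨?_, Eventually.of_forall fun k => ⟨hρ _, mem_univ _⟩⟩
    exact ((hlim.comp hns.tendsto_atTop).comp hms.tendsto_atTop).prodMk_nhds tendsto_const_nhds
  have hlimx : Tendsto (fun k => fiberLinear f₀ f (((x k).1 : ℂ) * s) (x k).2) atTop
      (𝓝 ((bil (fb s) z).re - (f₀ s).re)) := by
    have e1 : Tendsto (fun k => f (ρ (ns (ms k)) * s)) atTop (𝓝 (fb s)) := by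
      refine (h1.comp hms.tendsto_atTop).congr fun k => ?_
      exact (hf.eq_poisson _ (ofReal_mul_circle_mem (hρ _) s)).symm
    exact ((Complex.continuous_re.tendsto _).comp (tendsto_bil e1 tendsto_const_nhds)).sub h2
  have h3 := ((EReal.tendsto_coe.2 hlimx).limsup_eq).symm
  rw [h3]
  refine le_trans ?_ (hs z)
  exact limsup_le_limsup_of_le (f := map x atTop)
    (u := fun y : ℝ × EuclideanSpace ℂ (Fin n) =>
      ((fiberLinear f₀ f ((y.1 : ℂ) * (s : ℂ)) y.2 : ℝ) : EReal)) hx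

/-- Poisson integrals of lower semicontinuous functions have the expected radial lower limits. -/
theorem eventually_le_poisson_of_lowerSemicontinuous {g : Circle → EReal}
    (hg : LowerSemicontinuous g) (hgi : Integrable (fun s => (g s).toReal) arcMeasure)
    (hgt : ∀ᵐ s ∂arcMeasure, g s < ⊤) {A : ℝ} (hA : ∀ s, (A : EReal) < g s) {s : Circle} {a : ℝ}
    (ha : (a : EReal) < g s) :
    ∀ᶠ r : ℝ in 𝓝[Ioo 0 1] 1, a ≤ poisson (fun s => (g s).toReal) (r * s) := by
  obtain ⟨a', haa', ha'⟩ := EReal.lt_iff_exists_real_btwn.1 ha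
  have haa' : a < a' := EReal.coe_lt_coe_iff.1 haa'
  obtain ⟨δ, hδ, hball⟩ := Metric.eventually_nhds_iff.1 (hg s a' ha')
  let K : ℝ := (|a'| + |A|) / δ
  have hK : 0 ≤ K := by positivity
  -- A continuous minorant of `g` peaking at `s`: it is at most `a'` near `s`, and `K` pushes it
  -- below `A` at distance at least `δ`. Its Poisson integral attains its boundary values.
  let m : Circle → ℝ := fun x => a' - K * ‖(x : ℂ) - s‖
  have hm : Continuous m := by fun_prop
  have hmg : ∀ᵐ x ∂arcMeasure, m x ≤ (g x).toReal := by
    filter_upwards [hgt] with x hx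
    rw [← EReal.coe_le_coe_iff, EReal.coe_toReal hx.ne ((EReal.bot_lt_coe A).trans (hA x)).ne']
    rcases lt_or_ge (dist x s) δ with hd | hd
    · refine le_trans (EReal.coe_le_coe_iff.2 ?_) (hball hd).le
      simp only [m]
      nlinarith [norm_nonneg ((x : ℂ) - s)]
    · refine le_trans (EReal.coe_le_coe_iff.2 ?_) (hA x).le
      have h1 : δ ≤ ‖(x : ℂ) - s‖ := by rwa [← Complex.dist_eq]
      have h2 : |a'| + |A| ≤ K * ‖(x : ℂ) - s‖ := by
        calc |a'| + |A| = K * δ := by simp only [K]; field_simp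
          _ ≤ _ := by gcongr
      simp only [m]
      linarith [le_abs_self a', neg_abs_le A]
  obtain ⟨r₀, hr₀, H⟩ := exists_forall_norm_poisson_sub_le hm (sub_pos.2 haa')
  filter_upwards [self_mem_nhdsWithin, mem_nhdsWithin_of_mem_nhds (lt_mem_nhds hr₀)] with r hr hr1
  have h1 := poisson_mono_ae (ofReal_mul_circle_mem hr s) (continuous_integrable hm) hgi hmg
  have h2 := (abs_le.1 (H r hr hr1 s)).1
  have h3 : m s = a' := by simp [m]
  linarith

/-- A function of the disc algebra together with a lower semicontinuous majorant of the conjugate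
satisfies the boundary relation. -/
theorem boundaryLE_of_lowerSemicontinuous {G : ℂ → EuclideanSpace ℂ (Fin n)}
    (hG : DiffContOnCl ℂ G (ball 0 1)) {g : Circle → EReal} (hg : LowerSemicontinuous g)
    (hgi : Integrable (fun s => (g s).toReal) arcMeasure) (hgt : ∀ᵐ s ∂arcMeasure, g s < ⊤)
    {A : ℝ} (hA : ∀ s, (A : EReal) < g s) {ψ : Circle → ℝ} (hψ : ∀ s, (ψ s : EReal) < g s)
    (hψφ : ∀ (s : Circle) z, (((bil (G s) z).re - ψ s : ℝ) : EReal) ≤ φ s z) :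
    BoundaryLE (fiberLinear (fun s => ((g s).toReal : ℂ)) G) φ := by
  filter_upwards [hgt] with s hs z
  have hgs : ((g s).toReal : EReal) = g s :=
    EReal.coe_toReal hs.ne ((EReal.bot_lt_coe A).trans (hA s)).ne'
  have hψs : ψ s ≤ (g s).toReal := by
    rw [← EReal.coe_le_coe_iff, hgs]
    exact (hψ s).le
  refine le_trans ?_ ((EReal.coe_le_coe_iff.2 (sub_le_sub_left hψs _)).trans (hψφ s z))
  refine EReal.le_of_forall_lt_iff_le.1 fun b hb => ?_
  have hb : (bil (G s) z).re - (g s).toReal < b := EReal.coe_lt_coe_iff.1 hb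
  obtain ⟨ε, hε⟩ : ∃ ε, ε = (b - ((bil (G s) z).re - (g s).toReal)) / 2 := ⟨_, rfl⟩
  have hε0 : 0 < ε := by rw [hε]; linarith
  have hfst : Tendsto (fun x : ℝ × EuclideanSpace ℂ (Fin n) => x.1)
      (𝓝[Ioo (0 : ℝ) 1 ×ˢ univ] ((1 : ℝ), z)) (𝓝[Ioo 0 1] 1) := by
    refine tendsto_nhdsWithin_iff.2 ⟨(continuous_fst.tendsto _).mono_left nhdsWithin_le_nhds, ?_⟩
    exact eventually_nhdsWithin_of_forall fun x hx => hx.1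
  have hsnd : Tendsto (fun x : ℝ × EuclideanSpace ℂ (Fin n) => x.2)
      (𝓝[Ioo (0 : ℝ) 1 ×ˢ univ] ((1 : ℝ), z)) (𝓝 z) :=
    (continuous_snd.tendsto _).mono_left nhdsWithin_le_nhds
  have hGr : Tendsto (fun r : ℝ => G (r * s)) (𝓝[Ioo 0 1] 1) (𝓝 (G s)) := by
    have hs1 : (s : ℂ) ∈ closure (ball (0 : ℂ) 1) := by
      rw [closure_ball _ one_ne_zero]
      simp [Circle.norm_coe]
    refine (hG.continuousOn s hs1).tendsto.comp (tendsto_nhdsWithin_iff.2 ⟨?_, ?_⟩)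
    · have : Tendsto (fun r : ℝ => (r : ℂ) * s) (𝓝[Ioo 0 1] 1) (𝓝 (((1 : ℝ) : ℂ) * s)) :=
        ((by fun_prop : Continuous fun r : ℝ => (r : ℂ) * s).tendsto 1).mono_left
          nhdsWithin_le_nhds
      simpa using this
    · exact eventually_nhdsWithin_of_forall fun r hr => subset_closure (ofReal_mul_circle_mem hr s)
  have h1 : Tendsto (fun x : ℝ × EuclideanSpace ℂ (Fin n) => (bil (G (x.1 * s)) x.2).re)
      (𝓝[Ioo (0 : ℝ) 1 ×ˢ univ] ((1 : ℝ), z)) (𝓝 (bil (G s) z).re) :=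
    (Complex.continuous_re.tendsto _).comp (tendsto_bil (hGr.comp hfst) hsnd)
  -- Semicontinuity of `g` gives this radial lower bound at every `s` with `g s` finite, while `G`
  -- is continuous up to the circle; together they control the joint limit in `(r, w)`.
  have h2 := hfst.eventually (eventually_le_poisson_of_lowerSemicontinuous hg hgi hgt hA
    (s := s) (a := (g s).toReal - ε) (by
      refine lt_of_lt_of_eq (EReal.coe_lt_coe_iff.2 ?_) hgs
      linarith))
  refine limsup_le_of_le (by isBoundedDefault) ?_
  filter_upwards [h1.eventually (gt_mem_nhds (lt_add_of_pos_right _ hε0)), h2] with x hx1 hx2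
  rw [EReal.coe_le_coe_iff, fiberLinear]
  simp only [Complex.ofReal_re]
  linarith

/-- The boundary values of a function of the disc algebra are those of a Hardy function. -/
theorem isHardy_of_diffContOnCl {G : ℂ → EuclideanSpace ℂ (Fin n)}
    (hG : DiffContOnCl ℂ G (ball 0 1)) (q : ℝ≥0∞) : IsHardy q G fun s => G s where
  holomorphic := hG.differentiableOn
  memLp := continuous_memLp hG.continuous_circle q
  eq_poisson _ ht := (poisson_of_diffContOnCl hG ht).symm

/-- Along a Hardy function the fiberwise linear function becomes harmonic, because the product of
`f` and `F` is recovered from its boundary values. -/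
theorem fiberLinear_eq_poisson [q.HolderConjugate p] (hq' : q ≠ ∞) {f₀ : Circle → ℂ}
    (hf₀ : Integrable f₀ arcMeasure) {f F : ℂ → EuclideanSpace ℂ (Fin n)}
    {fb Fb : Circle → EuclideanSpace ℂ (Fin n)} (hf : IsHardy q f fb) (hF : IsHardy p F Fb) {t : ℂ}
    (ht : t ∈ ball (0 : ℂ) 1) :
    fiberLinear f₀ f t (F t) = poisson (fun s => (bil (fb s) (Fb s)).re - (f₀ s).re) t := by
  have hi := integrable_bil (q := q) (p := p) hf.memLp hF.memLp
  rw [poisson_sub (h := fun s => (bil (fb s) (Fb s)).re) (g := fun s => (f₀ s).re) ht hi.re hf₀.re,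
    fiberLinear, ← hf.poisson_bil hq' hF ht, poisson_def,
    ← RCLike.re_eq_complex_re, ← integral_re (integrable_kernel_smul ht hi), poisson_def, poisson_def]
  simp

/-! ### The harmonic measure of a point of the disc -/

/-- The harmonic measure of the disc at the point `t`. -/
noncomputable def harmonicMeasure (t : ℂ) : Measure Circle :=
  arcMeasure.withDensity fun s => ENNReal.ofReal (kernel t s)

section HarmonicMeasure

variable {t : ℂ} {E : Type*} [NormedAddCommGroup E] [NormedSpace ℝ E] {h : Circle → E}

theorem isProbabilityMeasure_harmonicMeasure (ht : t ∈ ball (0 : ℂ) 1) :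
    IsProbabilityMeasure (harmonicMeasure t) :=
  ⟨by rw [harmonicMeasure, withDensity_apply _ .univ, Measure.restrict_univ, lintegral_kernel ht]⟩

theorem measurable_ofReal_kernel (ht : t ∈ ball (0 : ℂ) 1) :
    Measurable fun s => ENNReal.ofReal (kernel t s) :=
  (continuous_kernel ht).measurable.ennreal_ofReal

theorem integral_harmonicMeasure (ht : t ∈ ball (0 : ℂ) 1) (h : Circle → E) :
    ∫ s, h s ∂harmonicMeasure t = poisson h t := by
  rw [harmonicMeasure, integral_withDensity_eq_integral_toReal_smul (measurable_ofReal_kernel ht)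
    (ae_of_all _ fun s => ENNReal.ofReal_lt_top), poisson_def]
  simp only [ENNReal.toReal_ofReal (kernel_pos ht _).le]

theorem integrable_harmonicMeasure_iff (ht : t ∈ ball (0 : ℂ) 1) :
    Integrable h (harmonicMeasure t) ↔ Integrable h arcMeasure := by
  rw [harmonicMeasure, integrable_withDensity_iff_integrable_smul' (measurable_ofReal_kernel ht)
    (ae_of_all _ fun s => ENNReal.ofReal_lt_top)]
  simp only [ENNReal.toReal_ofReal (kernel_pos ht _).le]
  refine ⟨fun hi => ?_, integrable_kernel_smul ht⟩
  obtain ⟨a, b, ha, hb, hab⟩ := exists_kernel_bounds ht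
  have hc : Continuous fun s => (kernel t s)⁻¹ :=
    (continuous_kernel ht).inv₀ fun s => (kernel_pos ht s).ne'
  have := hi.bdd_smul (φ := fun s => (kernel t s)⁻¹) a⁻¹ hc.aestronglyMeasurable
    (ae_of_all _ fun s => by
      rw [Real.norm_of_nonneg (inv_nonneg.2 (kernel_pos ht s).le)]
      exact inv_anti₀ ha (hab s).1)
  refine this.congr (ae_of_all _ fun s => ?_)
  simp [smul_smul, inv_mul_cancel₀ (kernel_pos ht s).ne']

theorem ae_harmonicMeasure_iff (ht : t ∈ ball (0 : ℂ) 1) {P : Circle → Prop} :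
    (∀ᵐ s ∂harmonicMeasure t, P s) ↔ ∀ᵐ s ∂arcMeasure, P s := by
  rw [harmonicMeasure, ae_withDensity_iff (measurable_ofReal_kernel ht)]
  simp [kernel_pos ht]

end HarmonicMeasure

end DiscInterpolation

/-! ### The hull: bounds from the disc algebra and propagation by Harnack -/

namespace DiscInterpolation

variable {n : ℕ} {p q : ℝ≥0∞} {φ : Circle → EuclideanSpace ℂ (Fin n) → EReal}

/-- The conjugates of boundary values of functions in the disc algebra. -/
def discAlgebraConj (n : ℕ) : Submodule ℝ (boundedMeasurable Circle (EuclideanSpace ℂ (Fin n))) where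
  carrier := {g | ∃ G : ℂ → EuclideanSpace ℂ (Fin n), DiffContOnCl ℂ G (ball 0 1) ∧
    ∀ s : Circle, g.1 s = conjVec (G s)}
  zero_mem' := ⟨fun _ => 0, diffContOnCl_const, fun s => by ext j; simp⟩
  add_mem' := by
    rintro f g ⟨F, hF, hf⟩ ⟨G, hG, hg⟩
    refine ⟨F + G, hF.add hG, fun s => ?_⟩
    have : (f + g).1 s = f.1 s + g.1 s := rfl
    rw [this, hf, hg]
    ext j
    simp
  smul_mem' := by
    rintro c f ⟨F, hF, hf⟩
    refine ⟨fun z => (c : ℂ) • F z, hF.const_smul (c : ℂ), fun s => ?_⟩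
    have : (c • f).1 s = c • f.1 s := rfl
    rw [this, hf]
    ext j
    simp

theorem exists_mem_discAlgebraConj {G : ℂ → EuclideanSpace ℂ (Fin n)}
    (hG : DiffContOnCl ℂ G (ball 0 1)) :
    ∃ g ∈ discAlgebraConj n, ∀ s : Circle, g.1 s = conjVec (G s) := by
  have hc : Continuous fun s : Circle => conjVec (G s) :=
    continuous_conjVec.comp hG.continuous_circle
  obtain ⟨y, -, hy⟩ := isCompact_univ.exists_isMaxOn univ_nonempty hc.norm.continuousOn
  exact ⟨⟨_, hc.measurable, _, fun s => hy (mem_univ s)⟩, ⟨G, hG, fun _ => rfl⟩, fun _ => rfl⟩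

/-- Evaluation at a point of the disc, paired with a fixed vector, extended to bounded functions. -/
noncomputable def evalPairing (t₀ : ℂ) (ht₀ : t₀ ∈ ball (0 : ℂ) 1)
    (w₀ : EuclideanSpace ℂ (Fin n)) :
    boundedMeasurable Circle (EuclideanSpace ℂ (Fin n)) →ₗ[ℝ] ℝ :=
  have := isProbabilityMeasure_harmonicMeasure ht₀
  { toFun := fun g => ∫ s, inner ℝ (g.1 s) w₀ ∂harmonicMeasure t₀
    map_add' := fun f g => by
      rw [← integral_add (integrable_boundedMeasurable_inner (integrable_const w₀) f)
        (integrable_boundedMeasurable_inner (integrable_const w₀) g)]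
      exact integral_congr_ae (ae_of_all _ fun s => inner_add_left _ _ _)
    map_smul' := fun a f => by
      simp only [RingHom.id_apply, smul_eq_mul]
      rw [← integral_const_mul]
      exact integral_congr_ae (ae_of_all _ fun s => real_inner_smul_left _ _ _) }

variable {t₀ : ℂ} {w₀ : EuclideanSpace ℂ (Fin n)}

/-- The Poisson formula at `t₀`. Only these values of `evalPairing` matter later; its values off the
disc algebra are an arbitrary linear extension. -/
theorem evalPairing_eq (ht₀ : t₀ ∈ ball (0 : ℂ) 1) {G : ℂ → EuclideanSpace ℂ (Fin n)}
    (hG : DiffContOnCl ℂ G (ball 0 1))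
    {g : boundedMeasurable Circle (EuclideanSpace ℂ (Fin n))}
    (hg : ∀ s : Circle, g.1 s = conjVec (G s)) :
    evalPairing t₀ ht₀ w₀ g = (bil (G t₀) w₀).re := by
  change ∫ s, inner ℝ (g.1 s) w₀ ∂harmonicMeasure t₀ = _
  have h1 : DiffContOnCl ℂ (fun z => bil (G z) w₀) (ball 0 1) :=
    diffContOnCl_bil hG diffContOnCl_const
  have h2 := continuous_integrable (μ := arcMeasure) h1.continuous_circle
  rw [← poisson_of_diffContOnCl h1 ht₀, integral_harmonicMeasure ht₀, poisson_def, poisson_def,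
    ← RCLike.re_eq_complex_re, ← integral_re (integrable_kernel_smul ht₀ h2)]
  refine integral_congr_ae (ae_of_all _ fun s => ?_)
  simp [hg, ← re_bil]

/-- Elements of the disc algebra give lower bounds for the hull. -/
theorem re_bil_sub_le_hull (ht₀ : t₀ ∈ ball (0 : ℂ) 1) {ψ : Circle → ℝ}
    (hψ : Integrable ψ (harmonicMeasure t₀)) {A : ℝ} (hA : ∀ s, A ≤ ψ s)
    {G : ℂ → EuclideanSpace ℂ (Fin n)} (hG : DiffContOnCl ℂ G (ball 0 1))
    (hψφ : ∀ (s : Circle) z, (((bil (G s) z).re - ψ s : ℝ) : EReal) ≤ φ s z) :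
    (((bil (G t₀) w₀).re - ∫ s, ψ s ∂harmonicMeasure t₀ : ℝ) : EReal) ≤ hull p φ t₀ w₀ := by
  have := isProbabilityMeasure_harmonicMeasure ht₀
  refine EReal.ge_of_forall_gt_iff_ge.1 fun b hb => ?_
  have hb := EReal.coe_lt_coe_iff.1 hb
  -- Vitali–Carathéodory: a lower semicontinuous `g > ψ` whose integral is larger by less than the
  -- slack in `b`.
  obtain ⟨g, hψg, hg, hgi, hgt, hint⟩ := exists_lt_lowerSemicontinuous_integral_lt ψ hψ
    (sub_pos.2 hb)
  rw [integrable_harmonicMeasure_iff ht₀] at hgi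
  rw [ae_harmonicMeasure_iff ht₀] at hgt
  have hle : BoundaryLE (fiberLinear (fun s => ((g s).toReal : ℂ)) G) φ :=
    boundaryLE_of_lowerSemicontinuous hG hg hgi hgt
      (fun s => (EReal.coe_le_coe_iff.2 (hA s)).trans_lt (hψg s)) hψg hψφ
  have hmem : ((fiberLinear (fun s => ((g s).toReal : ℂ)) G t₀ w₀ : ℝ) : EReal) ≤
      hull p φ t₀ w₀ :=
    le_sSup ⟨_, G, _, hgi.ofReal, isHardy_of_diffContOnCl hG _, hle, rfl⟩
  refine le_trans (EReal.coe_le_coe_iff.2 ?_) hmem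
  rw [integral_harmonicMeasure ht₀] at hint
  simp only [fiberLinear, Complex.ofReal_re]
  linarith

theorem conjExponent_ne_top (hp : 1 < p) : ENNReal.conjExponent p ≠ ∞ := by
  simp [ENNReal.conjExponent, tsub_eq_zero_iff_le, hp]

/-- Every admissible function is dominated by the Poisson integral of `φ(s, F(s))`, and the
difference is the Poisson integral of a nonnegative function. -/
theorem exists_nonneg_poisson_eq [q.HolderConjugate p] (hq' : q ≠ ∞) {f₀ : Circle → ℂ}
    (hf₀ : Integrable f₀ arcMeasure) {f F : ℂ → EuclideanSpace ℂ (Fin n)}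
    {fb Fb : Circle → EuclideanSpace ℂ (Fin n)} (hf : IsHardy q f fb) (hF : IsHardy p F Fb)
    (hle : BoundaryLE (fiberLinear f₀ f) φ) {H : Circle → ℝ} (hH : Integrable H arcMeasure)
    (hHφ : ∀ᵐ s ∂arcMeasure, φ s (Fb s) = (H s : EReal)) :
    ∃ v : Circle → ℝ, Integrable v arcMeasure ∧ (∀ᵐ s ∂arcMeasure, 0 ≤ v s) ∧
      ∀ t ∈ ball (0 : ℂ) 1, fiberLinear f₀ f t (F t) = poisson H t - poisson v t := by
  have hi : Integrable (fun s => (bil (fb s) (Fb s)).re - (f₀ s).re) arcMeasure :=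
    (integrable_bil (q := q) (p := p) hf.memLp hF.memLp).re.sub hf₀.re
  refine ⟨fun s => H s - ((bil (fb s) (Fb s)).re - (f₀ s).re), hH.sub hi, ?_, fun t ht => ?_⟩
  · filter_upwards [hle.ae_le hf₀ (ENNReal.HolderConjugate.one_le q p) hf, hHφ] with s h1 h2
    have h3 := h1 (Fb s)
    rw [h2, EReal.coe_le_coe_iff] at h3
    linarith
  · rw [poisson_sub ht hH hi, ← fiberLinear_eq_poisson hq' hf₀ hf hF ht, sub_sub_cancel]

/-- A function whose Poisson integral of `φ(s, F(s))` does not exceed the hull at one point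
realizes the hull everywhere. -/
theorem hull_eq_poisson (hp : 1 < p) (ht₀ : t₀ ∈ ball (0 : ℂ) 1)
    {F : ℂ → EuclideanSpace ℂ (Fin n)} {Fb : Circle → EuclideanSpace ℂ (Fin n)}
    (hF : IsHardy p F Fb) {H : Circle → ℝ} (hH : Integrable H arcMeasure)
    (hHφ : ∀ᵐ s ∂arcMeasure, φ s (Fb s) = (H s : EReal))
    (h₀ : ((poisson H t₀ : ℝ) : EReal) ≤ hull p φ t₀ (F t₀)) {t : ℂ} (ht : t ∈ ball (0 : ℂ) 1) :
    hull p φ t (F t) = ((poisson H t : ℝ) : EReal) := by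
  have : (ENNReal.conjExponent p).HolderConjugate p :=
    (ENNReal.HolderConjugate.conjExponent hp.le).symm
  have hq' := conjExponent_ne_top hp
  refine le_antisymm (sSup_le ?_) ?_
  · rintro x ⟨f₀, f, fb, hf₀, hf, hle, rfl⟩
    obtain ⟨v, hv, hv0, h⟩ := exists_nonneg_poisson_eq hq' hf₀ hf hF hle hH hHφ
    rw [h t ht, EReal.coe_le_coe_iff]
    have := poisson_mono_ae ht (integrable_zero _ _ _) hv hv0
    have h1 : poisson (0 : Circle → ℝ) t = 0 := by simp [poisson_def]
    linarith
  -- An admissible function within `ε` of `poisson H t₀` at `t₀` has a nonnegative defect `v` with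
  -- `P[v](t₀) < ε`. Harnack bounds `P[v](t)` by `C ε`, and `C ε = poisson H t - b`.
  · obtain ⟨C, hC, hHar⟩ := exists_poisson_le_mul ht ht₀
    refine EReal.ge_of_forall_gt_iff_ge.1 fun b hb => ?_
    have hb := EReal.coe_lt_coe_iff.1 hb
    obtain ⟨ε, hε⟩ : ∃ ε, ε = (poisson H t - b) / C := ⟨_, rfl⟩
    have hε0 : 0 < ε := by rw [hε]; exact div_pos (by linarith) hC
    have hlt : ((poisson H t₀ - ε : ℝ) : EReal) < hull p φ t₀ (F t₀) :=
      (EReal.coe_lt_coe_iff.2 (by linarith)).trans_le h₀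
    obtain ⟨x, ⟨f₀, f, fb, hf₀, hf, hle, rfl⟩, hx⟩ := lt_sSup_iff.1 hlt
    obtain ⟨v, hv, hv0, h⟩ := exists_nonneg_poisson_eq hq' hf₀ hf hF hle hH hHφ
    rw [h t₀ ht₀, EReal.coe_lt_coe_iff] at hx
    refine le_trans (EReal.coe_le_coe_iff.2 ?_) (le_sSup ⟨f₀, f, fb, hf₀, hf, hle, rfl⟩)
    rw [h t ht]
    have h1 := hHar v hv hv0
    have h2 : C * poisson v t₀ ≤ C * ε := by gcongr; linarith
    have h3 : C * ε = poisson H t - b := by rw [hε]; field_simp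
    linarith

theorem bil_smul_smul_comm (c : ℂ) (e x : EuclideanSpace ℂ (Fin n)) :
    bil (c • e) x = bil e (c • x) := by
  rw [bil_smul_left, bil_comm e, bil_comm e, bil_smul_left]

/-- An integrable function that represents the evaluation at `t₀` on the disc algebra is the
boundary function of a Hardy function with the given value at `t₀`. -/
theorem isHardy_of_evalPairing (hp : 1 ≤ p) (ht₀ : t₀ ∈ ball (0 : ℂ) 1)
    {F : Circle → EuclideanSpace ℂ (Fin n)} (hF : MemLp F p arcMeasure)
    (h : ∀ g ∈ discAlgebraConj n,
      evalPairing t₀ ht₀ w₀ g = ∫ s, inner ℝ (g.1 s) (F s) ∂harmonicMeasure t₀) :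
    IsHardy p (poisson F) F ∧ poisson F t₀ = w₀ := by
  have hFi : Integrable F arcMeasure := hF.integrable hp
  have key : ∀ G : ℂ → ℂ, DiffContOnCl ℂ G (ball 0 1) →
      poisson (fun s => G s • F s) t₀ = G t₀ • w₀ := by
    intro G hG
    have hGF : Integrable (fun s : Circle => G s • F s) (harmonicMeasure t₀) := by
      rw [integrable_harmonicMeasure_iff ht₀]
      exact integrable_continuous_smul hG.continuous_circle hFi
    -- Testing with the vector functions `G • conjVec e` for all `e` recovers the complex vector
    -- identity from its real pairings.
    refine ext_inner_left ℝ fun e => ?_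
    have hGe : DiffContOnCl ℂ (fun z => G z • conjVec e) (ball 0 1) := hG.smul_const _
    obtain ⟨g, hg, hgG⟩ := exists_mem_discAlgebraConj hGe
    have h1 := h g hg
    rw [evalPairing_eq ht₀ hGe hgG, bil_smul_smul_comm, re_bil, conjVec_conjVec] at h1
    rw [h1, ← integral_harmonicMeasure ht₀, ← integral_inner hGF]
    refine integral_congr_ae (ae_of_all _ fun s => ?_)
    simp only [hgG]
    rw [← re_bil, bil_smul_smul_comm, re_bil, conjVec_conjVec]
  refine ⟨⟨differentiableOn_poisson_of_annihilates ht₀ hFi fun G hG h0 => ?_, hF,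
    fun _ _ => rfl⟩, ?_⟩
  · rw [key G hG, h0, zero_smul]
  · simpa using key (fun _ => 1) diffContOnCl_const

end DiscInterpolation

/-! ### Construction of the extremal Hardy function -/

open DiscInterpolation in
theorem mainTheorem1 {n : ℕ} (p : ℝ≥0∞) (hp : 1 < p)
    (φ : Circle → EuclideanSpace ℂ (Fin n) → EReal)
    (hmeas : Measurable (fun x : Circle × EuclideanSpace ℂ (Fin n) => φ x.1 x.2))
    (hconv : ∀ s, DiscInterpolation.IsConvexFun (φ s))
    (hgrowth : DiscInterpolation.UniformGrowth p φ)
    (t₀ : ℂ) (ht₀ : t₀ ∈ ball (0 : ℂ) 1) (w₀ : EuclideanSpace ℂ (Fin n))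
    (hfin : DiscInterpolation.hull p φ t₀ w₀ < ⊤) :
    ∃ (F : ℂ → EuclideanSpace ℂ (Fin n)) (Fb : Circle → EuclideanSpace ℂ (Fin n)),
      DiscInterpolation.IsHardy p F Fb ∧ F t₀ = w₀ ∧
      (∀ᵐ s ∂DiscInterpolation.arcMeasure, φ s (Fb s) < ⊤) ∧
      Integrable (fun s => (φ s (Fb s)).toReal) DiscInterpolation.arcMeasure ∧
      (∀ t ∈ ball (0 : ℂ) 1, DiscInterpolation.hull p φ t (F t) =
        ((DiscInterpolation.poisson (fun s => (φ s (Fb s)).toReal) t : ℝ) : EReal)) ∧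
      InnerProductSpace.HarmonicOnNhd (fun t => (DiscInterpolation.hull p φ t (F t)).toReal)
        (ball (0 : ℂ) 1) := by
  have := isProbabilityMeasure_harmonicMeasure ht₀
  obtain ⟨δ, B, N, hsup⟩ := hgrowth.exists_isSuperlinear hp hconv
  let w : ℕ → EuclideanSpace ℂ (Fin n) := TopologicalSpace.denseSeq _
  have hw : DenseRange w := TopologicalSpace.denseRange_denseSeq _
  have hψ := isConvexIntegrand_conjugate hsup hmeas hw
  -- Young's inequality makes `G`, with the conjugate of `φ` along `g`, a competitor for the hull.
  -- This is the domination required by duality.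
  have hlow : ∀ g ∈ discAlgebraConj n, ((evalPairing t₀ ht₀ w₀ g -
      ∫ s, conjugate w (φ s) (g.1 s) ∂harmonicMeasure t₀ : ℝ) : EReal) ≤ hull p φ t₀ w₀ := by
    rintro g ⟨G, hG, hgG⟩
    rw [evalPairing_eq ht₀ hG hgG]
    refine re_bil_sub_le_hull ht₀ (hψ.integrable g) (fun s => (hsup s).conjugate_ge hw _) hG
      fun s z => ?_
    rcases eq_or_lt_of_le (le_top (a := φ s z)) with hz | hz
    · rw [hz]
      exact le_top
    · rw [← (hsup s).coe_toReal hz, EReal.coe_le_coe_iff, re_bil, ← hgG]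
      linarith [(hsup s).inner_sub_le_conjugate hw (g.1 s) hz]
  -- The competitor `g = 0` shows that the hull is not `⊥`, so its value is a real number.
  have hbot : hull p φ t₀ w₀ ≠ ⊥ := ((EReal.bot_lt_coe _).trans_le (hlow 0 (zero_mem _))).ne'
  have hm := EReal.coe_toReal hfin.ne hbot
  -- The same dense sequence `w` defines the conjugates and supplies the test vectors for the
  -- biconjugate.
  obtain ⟨F, hFm, hFi, hFg, U, hU, hUm, hFU⟩ := hψ.exists_dual (harmonicMeasure t₀)
    (discAlgebraConj n) (evalPairing t₀ ht₀ w₀) (hull p φ t₀ w₀).toReal (fun g hg => by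
      have := hlow g hg
      rw [← hm, EReal.coe_le_coe_iff] at this
      linarith) w
  rw [ae_harmonicMeasure_iff ht₀] at hFU
  rw [integrable_harmonicMeasure_iff ht₀] at hU
  have hφU : ∀ᵐ s ∂arcMeasure, φ s (F s) ≤ (U s : EReal) :=
    hFU.mono fun s hs => (hsup s).le_of_forall_inner_sub_conjugate_le hw hw hs
  have hφt : ∀ᵐ s ∂arcMeasure, φ s (F s) < ⊤ :=
    hφU.mono fun s hs => hs.trans_lt (EReal.coe_lt_top _)
  have hφH : ∀ᵐ s ∂arcMeasure, φ s (F s) = ((φ s (F s)).toReal : EReal) :=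
    hφt.mono fun s hs => ((hsup s).coe_toReal hs).symm
  have hle : ∀ᵐ s ∂arcMeasure, (φ s (F s)).toReal ≤ U s := by
    filter_upwards [hφU, hφH] with s h1 h2
    rwa [h2, EReal.coe_le_coe_iff] at h1
  have hH : Integrable (fun s => (φ s (F s)).toReal) arcMeasure := by
    refine (hU.norm.add (integrable_const |N 0|)).mono'
      (hmeas.comp (measurable_id.prodMk hFm)).ereal_toReal.aestronglyMeasurable ?_
    filter_upwards [hle, hφt] with s h1 h2
    have h3 := (hsup s).toReal_ge 0 h2
    rw [Real.norm_eq_abs, abs_le]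
    simp only [Pi.add_apply, Real.norm_eq_abs]
    constructor <;> linarith [le_abs_self (U s), abs_nonneg (U s), le_abs_self (N 0),
      abs_nonneg (N 0)]
  have hFp : MemLp F p arcMeasure := hgrowth.memLp hp hFm.aestronglyMeasurable hU hφU
  obtain ⟨hHardy, hFt₀⟩ := isHardy_of_evalPairing hp.le ht₀ hFp hFg
  -- Here `φ s (F s) ≤ U s`, and the integral of `U` against the harmonic measure is at most the
  -- hull at `t₀`.
  have h₀ : ((poisson (fun s => (φ s (F s)).toReal) t₀ : ℝ) : EReal) ≤
      hull p φ t₀ (poisson F t₀) := by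
    rw [hFt₀, ← hm, EReal.coe_le_coe_iff]
    refine (poisson_mono_ae ht₀ hH hU hle).trans ?_
    rwa [← integral_harmonicMeasure ht₀]
  have hhull := fun t ht => hull_eq_poisson hp ht₀ hHardy hH hφH h₀ (t := t) ht
  refine ⟨poisson F, F, hHardy, hFt₀, hφt, hH, hhull, fun t ht => ?_⟩
  refine (InnerProductSpace.harmonicAt_congr_nhds ?_).1 (harmonicOnNhd_poisson hH t ht)
  filter_upwards [isOpen_ball.mem_nhds ht] with x hx
  rw [hhull x hx, EReal.toReal_coe]
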